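/- **Proposition 2.2.** Let $N\ge 3$ be an integer, $0<\alpha<2N-2$, $\alpha\neq 2$, and set $2^*:=\frac{2N}{N-2}$ and $2^*_\alpha:=2\,\frac{2N-2+\alpha}{2N-2-\alpha}$. Let $p_1,p_2>2$ with $p_1\le 2^*\le p_2$, and let $f:\mathbb{R}\to\mathbb{R}$ be a continuous function such that - $f(s)=0$ for all $s<0$; - there is $M>0$ with $0<f(s)\le M\min\{s^{p_1-1},s^{p_2-1}\}$ for all $s>0$; - $s\mapsto f(s)/s$ is nondecreasing on $(0,+\infty)$. Put $F(s):=\int_0^s f(t)\,dt$. Let $D^{1,2}(\mathbb{R}^N)$ be the completion of $C_c^\infty(\mathbb{R}^N)$ with respect to the norm $\|\nabla\varphi\|_{L^2}$, regarded as a space of functions in $L^{2^*}(\mathbb{R}^N)$. For $A>0$ let $H^1_\alpha:=\{u\in D^{1,2}(\mathbb{R}^N):\int_{\mathbb{R}^N}|x|^{-\alpha}u^2\,dx<\infty\}$ be the Hilbert space with norm $$\|u\|_A^2:=\int_{\mathbb{R}^N}\Big(|\nabla u|^2+\frac{A}{|x|^\alpha}u^2\Big)dx ,$$ let $H_r$ be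 its subspace of radial functions ($u(x)=u(|x|)$ for almost every $x$), and define $I:H^1_\alpha\to\mathbb{R}$ by $$I(u):=\frac12\|u\|_A^2-\int_{\mathbb{R}^N}F(u)\,dx .$$ Let $$m_A:=\inf\{I(u):u\in H_r\setminus\{0\},\ I'(u)=0\},$$ where $I'$ is the Fréchet derivative of $I$ on $H^1_\alpha$ and $\inf\emptyset=+\infty$. Let $p:=\max\{2^*_\alpha,p_1\}$ if $0<\alpha<2$ and $p:=\min\{2^*_\alpha,p_2\}$ if $2<\alpha<2N-2$. Then there exists a constant $C_0>0$, independent of $A$, such that for every $A>0$ $$m_A\ \ge\ C_0\,A^{\frac{N-2}{\alpha-2}\cdot\frac{p-2^*}{p-2}} .$$ -/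

import Mathlib

open MeasureTheory Filter Topology
open scoped ENNReal ContDiff

noncomputable section

namespace RadialLevels

/-- The Euclidean space `ℝ^N`. -/
abbrev Space (N : ℕ) : Type := EuclideanSpace ℝ (Fin N)

/-- The critical Sobolev exponent `2^* = 2N/(N-2)`. -/
def sobolevExp (N : ℕ) : ℝ := 2 * (N : ℝ) / ((N : ℝ) - 2)

/-- The exponent `2^*_α = 2(2N-2+α)/(2N-2-α)`. -/
def radialExp (N : ℕ) (α : ℝ) : ℝ :=
  2 * ((2 * (N : ℝ) - 2 + α) / (2 * (N : ℝ) - 2 - α))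

/-- `u ∈ D^{1,2}(ℝ^N)` and `G = ∇u`, where `D^{1,2}(ℝ^N)` is the completion of `C_c^∞(ℝ^N)` for
the norm `‖∇φ‖_{L²}`, realized (for `N ≥ 3`, by the Sobolev inequality) as a space of functions
in `L^{2^*}`: `u` is the `L^{2^*}`-limit of test functions whose gradients converge to `G`
in `L²`. Both `u` and `G` matter only up to equality almost everywhere. -/
def MemD12 (N : ℕ) (u : Space N → ℝ) (G : Space N → Space N) : Prop :=
  MemLp u (ENNReal.ofReal (sobolevExp N)) volume ∧ MemLp G 2 volume ∧
  ∃ φ : ℕ → Space N → ℝ,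
    (∀ n, ContDiff ℝ ∞ (φ n) ∧ HasCompactSupport (φ n)) ∧
    Tendsto (fun n => eLpNorm (φ n - u) (ENNReal.ofReal (sobolevExp N)) volume) atTop (𝓝 0) ∧
    Tendsto (fun n => eLpNorm (gradient (φ n) - G) 2 volume) atTop (𝓝 0)

/-- The measure `A |x|^{-α} dx`. For `A > 0` and `N ≥ 1` it has the same null sets as Lebesgue
measure. -/
def potMeasure (N : ℕ) (α A : ℝ) : Measure (Space N) :=
  (volume : Measure (Space N)).withDensity (fun x => ENNReal.ofReal (A / ‖x‖ ^ α))

lemma gradient_add' {N : ℕ} {φ ψ : Space N → ℝ} (hφ : ContDiff ℝ ∞ φ) (hψ : ContDiff ℝ ∞ ψ) :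
    gradient (φ + ψ) = gradient φ + gradient ψ := by
  funext x
  have h1 := (hφ.differentiable (by simp)) x
  have h2 := (hψ.differentiable (by simp)) x
  simp [gradient, fderiv_add h1 h2]

lemma gradient_smul' {N : ℕ} {φ : Space N → ℝ} (c : ℝ) (hφ : ContDiff ℝ ∞ φ) :
    gradient (c • φ) = c • gradient φ := by
  funext x
  have h1 := (hφ.differentiable (by simp)) x
  simp [gradient, fderiv_const_smul h1 c]

lemma memD12_zero (N : ℕ) : MemD12 N 0 0 := by
  refine ⟨MemLp.zero, MemLp.zero, fun _ => 0, fun _ => ⟨contDiff_const, HasCompactSupport.zero⟩,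
    ?_, ?_⟩
  · simp
  · have : gradient (0 : Space N → ℝ) = 0 := by
      funext x
      simp [gradient]
    simp [this]

lemma MemD12.congr {N : ℕ} {u : Space N → ℝ} {G G' : Space N → Space N}
    (h : MemD12 N u G) (hG : G =ᵐ[volume] G') : MemD12 N u G' := by
  obtain ⟨h1, h2, φ, h3, h4, h5⟩ := h
  refine ⟨h1, (memLp_congr_ae hG).1 h2, φ, h3, h4, ?_⟩
  refine h5.congr fun n => eLpNorm_congr_ae ?_
  filter_upwards [hG] with x hx
  simp [hx]

lemma one_le_sobolevExp_or (N : ℕ) :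
    1 ≤ ENNReal.ofReal (sobolevExp N) ∨ ENNReal.ofReal (sobolevExp N) = 0 := by
  by_cases h : 3 ≤ N
  · left
    have h' : (3 : ℝ) ≤ N := by exact_mod_cast h
    rw [ENNReal.one_le_ofReal, sobolevExp, le_div_iff₀ (by linarith)]
    linarith
  · right
    rw [ENNReal.ofReal_eq_zero, sobolevExp]
    have h' : (N : ℝ) ≤ 2 := by
      have : N ≤ 2 := by omega
      exact_mod_cast this
    exact div_nonpos_of_nonneg_of_nonpos (by positivity) (by linarith)

lemma MemD12.add {N : ℕ} {u v : Space N → ℝ} {G K : Space N → Space N}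
    (hu : MemD12 N u G) (hv : MemD12 N v K) : MemD12 N (u + v) (G + K) := by
  obtain ⟨h1, h2, φ, h3, h4, h5⟩ := hu
  obtain ⟨k1, k2, ψ, k3, k4, k5⟩ := hv
  refine ⟨h1.add k1, h2.add k2, fun n => φ n + ψ n,
    fun n => ⟨(h3 n).1.add (k3 n).1, (h3 n).2.add (k3 n).2⟩, ?_, ?_⟩
  · rcases one_le_sobolevExp_or N with hp | hp
    · refine tendsto_of_tendsto_of_tendsto_of_le_of_le tendsto_const_nhds
        (by simpa using h4.add k4) (fun _ => zero_le) fun n => ?_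
      have e : φ n + ψ n - (u + v) = (φ n - u) + (ψ n - v) := by ring
      simp only [e]
      exact eLpNorm_add_le ((h3 n).1.continuous.aestronglyMeasurable.sub h1.1)
        ((k3 n).1.continuous.aestronglyMeasurable.sub k1.1) hp
    · simp [hp]
  · refine tendsto_of_tendsto_of_tendsto_of_le_of_le tendsto_const_nhds
        (by simpa using h5.add k5) (fun _ => zero_le) fun n => ?_
    have e : gradient (φ n + ψ n) - (G + K) = (gradient (φ n) - G) + (gradient (ψ n) - K) := by
      rw [gradient_add' (h3 n).1 (k3 n).1]
      abel
    have c : ∀ {χ : Space N → ℝ}, ContDiff ℝ ∞ χ → Continuous (gradient χ) := fun h =>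
      (InnerProductSpace.toDual ℝ (Space N)).symm.continuous.comp (h.continuous_fderiv (by simp))
    simp only [e]
    exact eLpNorm_add_le ((c (h3 n).1).aestronglyMeasurable.sub h2.1)
        ((c (k3 n).1).aestronglyMeasurable.sub k2.1) (by norm_num)

lemma MemD12.smul {N : ℕ} {u : Space N → ℝ} {G : Space N → Space N} (c : ℝ)
    (hu : MemD12 N u G) : MemD12 N (c • u) (c • G) := by
  obtain ⟨h1, h2, φ, h3, h4, h5⟩ := hu
  refine ⟨h1.const_smul c, h2.const_smul c, fun n => c • φ n,
    fun n => ⟨contDiff_const.smul (h3 n).1, (h3 n).2.smul_left (f := fun _ => c)⟩, ?_, ?_⟩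
  · have := ENNReal.Tendsto.const_mul (a := ‖c‖ₑ) h4 (Or.inr enorm_ne_top)
    simpa [← smul_sub, eLpNorm_const_smul] using this
  · have := ENNReal.Tendsto.const_mul (a := ‖c‖ₑ) h5 (Or.inr enorm_ne_top)
    simp only [gradient_smul' c (h3 _).1, ← smul_sub, eLpNorm_const_smul]
    simpa using this

/-- The Hilbert space `H^1_α = {u ∈ D^{1,2}(ℝ^N) : ∫ u²/|x|^α dx < ∞}` with the scalar product
`(u,v)_A = ∫ (∇u · ∇v + A |x|^{-α} u v) dx`. A function `u` is represented by the pair `(∇u, u)` in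
the Hilbert sum `L²(dx; ℝ^N) ⊕ L²(A |x|^{-α} dx)`, so that the inherited norm is `‖·‖_A`. -/
def energySpace (N : ℕ) (α A : ℝ) :
    Submodule ℝ (WithLp 2
      (Lp (Space N) 2 (volume : Measure (Space N)) × Lp ℝ 2 (potMeasure N α A))) where
  carrier := {w | ∃ u : Space N → ℝ, MemD12 N u w.fst ∧ u =ᵐ[potMeasure N α A] w.snd}
  zero_mem' := ⟨0, (memD12_zero N).congr (Lp.coeFn_zero _ _ _).symm, (Lp.coeFn_zero _ _ _).symm⟩
  add_mem' := by
    rintro w z ⟨u, hu, hu'⟩ ⟨v, hv, hv'⟩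
    exact ⟨u + v, (hu.add hv).congr (Lp.coeFn_add _ _).symm,
      (hu'.add hv').trans (Lp.coeFn_add _ _).symm⟩
  smul_mem' := by
    rintro c w ⟨u, hu, hu'⟩
    exact ⟨c • u, (hu.smul c).congr (Lp.coeFn_smul _ _).symm,
      (hu'.const_smul c).trans (Lp.coeFn_smul _ _).symm⟩

/-- The function `u : ℝ^N → ℝ` underlying an element of `H^1_α`, determined up to a null set. -/
def toFun {N : ℕ} {α A : ℝ} (u : energySpace N α A) : Space N → ℝ :=
  (u : WithLp 2 (Lp (Space N) 2 (volume : Measure (Space N)) × Lp ℝ 2 (potMeasure N α A))).snd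

/-- The weak gradient `∇u` of an element of `H^1_α`, determined up to a null set. -/
def grad {N : ℕ} {α A : ℝ} (u : energySpace N α A) : Space N → Space N :=
  (u : WithLp 2 (Lp (Space N) 2 (volume : Measure (Space N)) × Lp ℝ 2 (potMeasure N α A))).fst

/-- The scalar product of `energySpace` is `(u,v)_A`. -/
lemma inner_eq {N : ℕ} {α A : ℝ} (hA : 0 ≤ A) (u v : energySpace N α A) :
    inner ℝ u v = (∫ x, inner ℝ (grad u x) (grad v x)) +
      ∫ x, A / ‖x‖ ^ α * (toFun u x * toFun v x) := by
  rw [Submodule.coe_inner, WithLp.prod_inner_apply, L2.inner_def, L2.inner_def]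
  congr 1
  have key : ∀ g : Space N → ℝ, ∫ x, g x ∂(potMeasure N α A) = ∫ x, A / ‖x‖ ^ α * g x := by
    intro g
    rw [potMeasure, integral_withDensity_eq_integral_toReal_smul (by fun_prop) (by simp)]
    refine integral_congr_ae (Eventually.of_forall fun x => ?_)
    have : 0 ≤ A / ‖x‖ ^ α := by positivity
    simp [ENNReal.toReal_ofReal this]
  rw [key]
  refine integral_congr_ae (Eventually.of_forall fun x => ?_)
  simp [toFun, mul_comm]

/-- `u ∈ H_r`: `u(x) = u(|x|)` for almost every `x`. -/
def IsRadial {N : ℕ} {α A : ℝ} (u : energySpace N α A) : Prop :=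
  ∃ g : ℝ → ℝ, toFun u =ᵐ[volume] fun x => g ‖x‖

/-- The primitive `F(s) = ∫_0^s f(t) dt`. -/
def primitive (f : ℝ → ℝ) (s : ℝ) : ℝ := ∫ t in (0 : ℝ)..s, f t

/-- The Euler functional `I(u) = ½ ‖u‖_A² - ∫ F(u) dx` on `H^1_α`. -/
def energy (N : ℕ) (α A : ℝ) (f : ℝ → ℝ) (u : energySpace N α A) : ℝ :=
  1 / 2 * ‖u‖ ^ 2 - ∫ x, primitive f (toFun u x)

/-- `I'(u) = 0`, with the Fréchet derivative on the Hilbert space `(H^1_α, ‖·‖_A)`. -/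
def IsCritical (N : ℕ) (α A : ℝ) (f : ℝ → ℝ) (u : energySpace N α A) : Prop :=
  HasFDerivAt (energy N α A f) (0 : energySpace N α A →L[ℝ] ℝ) u

/-- `m_A = inf {I(u) : u ∈ H_r \ {0}, I'(u) = 0}`, an extended real number
(`+∞` if there is no such `u`). -/
def radialLevel (N : ℕ) (α A : ℝ) (f : ℝ → ℝ) : EReal :=
  sInf {c : EReal | ∃ u : energySpace N α A,
    IsRadial u ∧ u ≠ 0 ∧ IsCritical N α A f u ∧ c = ((energy N α A f u : ℝ) : EReal)}

/-- The double-power growth condition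
`0 < f(s) ≤ M min {s^{p₁-1}, s^{p₂-1}}` for all `s > 0`, for some `M > 0`. -/
def DoublePowerGrowth (f : ℝ → ℝ) (p₁ p₂ : ℝ) : Prop :=
  ∃ M : ℝ, 0 < M ∧ ∀ s : ℝ, 0 < s → 0 < f s ∧ f s ≤ M * min (s ^ (p₁ - 1)) (s ^ (p₂ - 1))

end RadialLevels

end

/-! A nonzero critical point `w` satisfies the Nehari identity `‖w‖² = ∫ f(w) w`. Since `f(s)/s` is
nondecreasing, the increment of `F` from `s` to `ts` is at least that of the parabola with the same
slope at `s`. Integrated over space, the Nehari identity cancels the quadratic terms and gives `I(t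
w) ≤ I(w)` for every `t ≥ 0`. It therefore suffices to bound `I` from below at one point of the ray,
chosen at a norm `τ` independent of `w`.

The choice of `p` places it both in `[p₁, p₂]`, so that `F(s) ≤ M |s|^p`, and between `2^*` and
`2^*_α`, so that radial functions satisfy `∫ |u|^p ≤ C A^{-e} ‖u‖_A^p` with `e =
(N-2)(p-2^*)/(2(α-2))` (`lintegral_rpow_le`). Hence `I ≥ τ²/2 - K τ^p` at norm `τ`, with `K = M C
A^{-e}`. Taking `K τ^p = τ²/4` leaves `τ²/4`, and `τ² = (4K)^{-2/(p-2)}` carries the stated power of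
`A`.

The embedding interpolates the Sobolev inequality, whose constant does not involve `A`, with the
bound in `L^{2^*_α}`. The latter follows from `radial_decay`: `|x|^{N-1-α/2} u²` is controlled by
the product of the weighted norm `‖|x|^{-α/2} u‖₂` and `‖∇u‖₂`. The decay is proved on test
functions, which need be neither radial nor close to `u` in the weighted norm. One therefore
estimates spherical integrals, with errors measured in `L²` on bounded annuli away from the origin,
then lets the approximation converge and finally sends the outer radius to infinity. -/

namespace RadialLevels

/-! ### Polar coordinates and null sets. -/

section Polar

open Module Measure

variable {E : Type*} [NormedAddCommGroup E] [NormedSpace ℝ E] [MeasurableSpace E] [BorelSpace E]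
  [FiniteDimensional ℝ E] [Nontrivial E] (μ : Measure E) [μ.IsAddHaarMeasure]

/-- Integration in polar coordinates. -/
lemma lintegral_polar {h : E → ℝ≥0∞} (hh : Measurable h) :
    ∫⁻ x, h x ∂μ = ∫⁻ w, (∫⁻ r in Set.Ioi (0 : ℝ),
      ENNReal.ofReal (r ^ (finrank ℝ E - 1)) * h (r • (w : E))) ∂μ.toSphere := by
  have h1 : ∫⁻ x, h x ∂μ = ∫⁻ x : ({0}ᶜ : Set E), h x ∂(μ.comap (↑)) := by
    rw [lintegral_subtype_comap (measurableSet_singleton _).compl, restrict_compl_singleton]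
  have h2 := (μ.measurePreserving_homeomorphUnitSphereProd).symm
    (homeomorphUnitSphereProd E).toMeasurableEquiv
  have h3 : Measurable fun p : Metric.sphere (0 : E) 1 × Set.Ioi (0 : ℝ) =>
      h ((p.2 : ℝ) • (p.1 : E)) := by fun_prop
  rw [h1, ← h2.lintegral_comp (by fun_prop)]
  simp only [Homeomorph.toMeasurableEquiv_symm_coe, homeomorphUnitSphereProd_symm_apply_coe]
  rw [lintegral_prod _ h3.aemeasurable]
  refine lintegral_congr fun w => ?_
  rw [volumeIoiPow, lintegral_withDensity_eq_lintegral_mul _ (by fun_prop) (by fun_prop)]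
  exact lintegral_subtype_comap measurableSet_Ioi
    (fun r : ℝ => ENNReal.ofReal (r ^ (finrank ℝ E - 1)) * h (r • (w : E)))

lemma lintegral_polar_swap {h : E → ℝ≥0∞} (hh : Measurable h) :
    ∫⁻ x, h x ∂μ = ∫⁻ r in Set.Ioi (0 : ℝ),
      ENNReal.ofReal (r ^ (finrank ℝ E - 1)) * ∫⁻ w, h (r • (w : E)) ∂μ.toSphere := by
  have h3 : Measurable fun p : Metric.sphere (0 : E) 1 × ℝ =>
      ENNReal.ofReal (p.2 ^ (finrank ℝ E - 1)) * h (p.2 • (p.1 : E)) := by fun_prop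
  rw [lintegral_polar μ hh, lintegral_lintegral_swap h3.aemeasurable]
  refine lintegral_congr fun r => ?_
  rw [lintegral_const_mul _ (by fun_prop)]

/-- Fubini in polar coordinates. It transfers almost everywhere convergence of test functions to
almost every sphere. -/
lemma ae_sphere_of_ae {P : E → Prop} (h : ∀ᵐ x ∂μ, P x) :
    ∀ᵐ r : ℝ, 0 < r → ∀ᵐ w : Metric.sphere (0 : E) 1 ∂μ.toSphere, P (r • (w : E)) := by
  -- `P` may be non-measurable, so the exceptional set is enlarged to a measurable null set before
  -- integrating its indicator.
  set t := toMeasurable μ {x | ¬ P x} with ht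
  have htm : MeasurableSet t := measurableSet_toMeasurable _ _
  have h0 : μ t = 0 := by rw [ht, measure_toMeasurable]; exact h
  have hi : Measurable (t.indicator (1 : E → ℝ≥0∞)) := measurable_one.indicator htm
  rw [← lintegral_indicator_one htm, lintegral_polar_swap μ hi, lintegral_eq_zero_iff',
    EventuallyEq, ae_restrict_iff' measurableSet_Ioi] at h0
  · filter_upwards [h0] with r hr hpos
    have h4 := hr hpos
    simp only [Pi.zero_apply, mul_eq_zero, ENNReal.ofReal_eq_zero] at h4
    rcases h4 with h4 | h4
    · exact absurd h4 (not_le.2 (pow_pos hpos _))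
    · rw [lintegral_eq_zero_iff (by fun_prop)] at h4
      filter_upwards [h4] with w hw
      by_contra hP
      have : r • (w : E) ∈ t := subset_toMeasurable _ _ hP
      simp [this] at hw
  · have h3 : Measurable fun p : ℝ × Metric.sphere (0 : E) 1 =>
      t.indicator (1 : E → ℝ≥0∞) (p.1 • (p.2 : E)) := by fun_prop
    have := h3.lintegral_prod_right' (ν := μ.toSphere)
    fun_prop

/-- Every ray meets the exceptional set in a one-dimensional null set. This turns a bound at almost
every radius into one at almost every point. -/
lemma ae_of_ae_norm {P : ℝ → Prop} (h : ∀ᵐ r : ℝ, 0 < r → P r) : ∀ᵐ x ∂μ, P ‖x‖ := by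
  set t := toMeasurable volume {r : ℝ | ¬ (0 < r → P r)} with ht
  have htm : MeasurableSet t := measurableSet_toMeasurable _ _
  have h0 : volume t = 0 := by rw [ht, measure_toMeasurable]; exact h
  have hi : Measurable (fun x : E => t.indicator (1 : ℝ → ℝ≥0∞) ‖x‖) :=
    (measurable_one.indicator htm).comp measurable_norm
  have h1 : ∫⁻ x, t.indicator (1 : ℝ → ℝ≥0∞) ‖x‖ ∂μ = 0 := by
    rw [lintegral_polar μ hi]
    refine (lintegral_congr fun w => ?_).trans lintegral_zero
    rw [lintegral_eq_zero_iff']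
    · have h2 : ∀ᵐ r : ℝ, r ∉ t := measure_eq_zero_iff_ae_notMem.1 h0
      rw [EventuallyEq, ae_restrict_iff' measurableSet_Ioi]
      filter_upwards [h2] with r hr hpos
      have : ‖r • (w : E)‖ = r := by simp [norm_smul, abs_of_pos (Set.mem_Ioi.1 hpos)]
      simp [this, hr]
    · fun_prop
  rw [lintegral_eq_zero_iff hi] at h1
  have h2 : ∀ᵐ x ∂μ, x ≠ 0 := by simp [ae_iff]
  filter_upwards [h1, h2] with x hx hx0
  by_contra hP
  have : ‖x‖ ∈ t := subset_toMeasurable _ _ fun hh => hP (hh (norm_pos_iff.2 hx0))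
  simp [this] at hx

end Polar

/-! ### The weighted estimate along a ray. -/

section Ray

/-- Weighted one-dimensional estimate along a ray. -/
lemma ray_estimate {N : ℕ} {φ : Space N → ℝ} (hφ : ContDiff ℝ ∞ φ) {γ r R : ℝ} (hγ : 0 < γ)
    (hr : 0 < r) (hrR : r ≤ R) {w : Space N} (hw : ‖w‖ = 1) :
    ENNReal.ofReal (r ^ γ) * ‖φ (r • w)‖ₑ ^ 2 ≤
      ENNReal.ofReal (R ^ γ) * ‖φ (R • w)‖ₑ ^ 2 + ∫⁻ s in Set.Ioc r R,
        ENNReal.ofReal (s ^ γ) * (2 * (‖φ (s • w)‖ₑ * ‖gradient φ (s • w)‖ₑ)) := by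
  have hd : Differentiable ℝ φ := hφ.differentiable (by simp)
  have hgc : Continuous (gradient φ) :=
    (InnerProductSpace.toDual ℝ (Space N)).symm.continuous.comp (hφ.continuous_fderiv (by simp))
  have hφc : Continuous φ := hφ.continuous
  set k : ℝ → ℝ := fun s => s ^ γ * (2 * (‖φ (s • w)‖ * ‖gradient φ (s • w)‖)) with hk
  have hkc : ContinuousOn k (Set.Icc r R) := by
    have : Continuous k := by
      have h1 : Continuous fun s : ℝ => s ^ γ := Real.continuous_rpow_const hγ.le
      fun_prop
    exact this.continuousOn
  have hψ : ∀ s, HasDerivAt (fun s : ℝ => φ (s • w)) (fderiv ℝ φ (s • w) w) s := by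
    intro s
    have h1 : HasDerivAt (fun s : ℝ => s • w) w s := by
      simpa using (hasDerivAt_id s).smul_const w
    exact (hd (s • w)).hasFDerivAt.comp_hasDerivAt s h1
  have hgrad : ∀ s : ℝ, |fderiv ℝ φ (s • w) w| ≤ ‖gradient φ (s • w)‖ := by
    intro s
    have := (fderiv ℝ φ (s • w)).le_opNorm w
    rw [hw, mul_one] at this
    simpa [gradient] using this
  -- Differentiating `-s^γ φ(sw)²` gives a term `-γ s^{γ-1} φ²`, which is nonpositive and is
  -- dropped. Only the cross term `φ · ∂φ` has to be bounded by `k`.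
  have key : (fun s : ℝ => -(s ^ γ * φ (s • w) ^ 2)) R - (fun s : ℝ => -(s ^ γ * φ (s • w) ^ 2)) r
      ≤ ∫ s in r..R, k s := by
    refine intervalIntegral.sub_le_integral_of_hasDeriv_right_of_le
      (g := fun s : ℝ => -(s ^ γ * φ (s • w) ^ 2)) (g' := fun s => -(γ * s ^ (γ - 1) * φ (s • w) ^ 2
        + s ^ γ * (2 * φ (s • w) * fderiv ℝ φ (s • w) w))) hrR ?_ ?_
      (hkc.integrableOn_Icc) ?_
    · have h1 : Continuous fun s : ℝ => s ^ γ := Real.continuous_rpow_const hγ.le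
      exact Continuous.continuousOn (by fun_prop)
    · intro s hs
      have hs0 : 0 < s := hr.trans hs.1
      have h1 := ((Real.hasDerivAt_rpow_const (p := γ) (Or.inl hs0.ne')).mul ((hψ s).pow 2)).neg
      refine HasDerivAt.hasDerivWithinAt (h1.congr_deriv ?_)
      simp
    · intro s hs
      have hs0 : 0 < s := hr.trans hs.1
      have h1 : 0 ≤ γ * s ^ (γ - 1) * φ (s • w) ^ 2 := by positivity
      have h2 : -(2 * φ (s • w) * fderiv ℝ φ (s • w) w)
          ≤ 2 * (‖φ (s • w)‖ * ‖gradient φ (s • w)‖) := by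
        calc _ ≤ |2 * φ (s • w) * fderiv ℝ φ (s • w) w| := neg_le_abs _
          _ = 2 * (‖φ (s • w)‖ * |fderiv ℝ φ (s • w) w|) := by
            rw [abs_mul, abs_mul, Real.norm_eq_abs]; simp [mul_assoc]
          _ ≤ _ := by gcongr; exact hgrad s
      have h3 := mul_le_mul_of_nonneg_left h2 (Real.rpow_nonneg hs0.le γ)
      simp only [hk]
      linarith
  have hk0 : ∀ s ∈ Set.Ioc r R, 0 ≤ k s := fun s hs => by
    have : 0 ≤ s := (hr.trans hs.1).le
    positivity
  have h5 : ENNReal.ofReal (∫ s in r..R, k s) = ∫⁻ s in Set.Ioc r R, ENNReal.ofReal (k s) := by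
    rw [intervalIntegral.integral_of_le hrR]
    refine ofReal_integral_eq_lintegral_ofReal ((hkc.integrableOn_Icc).mono_set Set.Ioc_subset_Icc_self) ?_
    exact (ae_restrict_iff' measurableSet_Ioc).2 (Eventually.of_forall hk0)
  have h6 : ∀ s : ℝ, 0 < s → ENNReal.ofReal (s ^ γ) * ‖φ (s • w)‖ₑ ^ 2
      = ENNReal.ofReal (s ^ γ * φ (s • w) ^ 2) := by
    intro s hs
    rw [ENNReal.ofReal_mul (Real.rpow_nonneg hs.le _), ← sq_abs, ENNReal.ofReal_pow (abs_nonneg _),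
      ← Real.enorm_eq_ofReal_abs]
  have h7 : ∫⁻ s in Set.Ioc r R, ENNReal.ofReal (k s) = ∫⁻ s in Set.Ioc r R,
        ENNReal.ofReal (s ^ γ) * (2 * (‖φ (s • w)‖ₑ * ‖gradient φ (s • w)‖ₑ)) := by
    refine setLIntegral_congr_fun measurableSet_Ioc fun s hs => ?_
    have : 0 ≤ s := (hr.trans hs.1).le
    simp only [hk]
    rw [ENNReal.ofReal_mul (Real.rpow_nonneg this _), ENNReal.ofReal_mul zero_le_two,
      ENNReal.ofReal_mul (norm_nonneg _), ofReal_norm, ofReal_norm]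
    simp
  have hR : 0 < R := hr.trans_le hrR
  rw [h6 r hr, h6 R hR, ← h7, ← h5, ← ENNReal.ofReal_add (by positivity)]
  · exact ENNReal.ofReal_le_ofReal (by simp only at key; linarith)
  · rw [intervalIntegral.integral_of_le hrR]
    exact setIntegral_nonneg measurableSet_Ioc hk0

end Ray

/-! ### Weighted integrals over annuli and spheres. -/

/-- The annulus `{a < |x| ≤ b}`. -/
def annulus (N : ℕ) (a b : ℝ) : Set (Space N) := {x | ‖x‖ ∈ Set.Ioc a b}

lemma measurableSet_annulus (N : ℕ) (a b : ℝ) : MeasurableSet (annulus N a b) :=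
  measurable_norm measurableSet_Ioc

lemma continuous_gradient {N : ℕ} {φ : Space N → ℝ} (hφ : ContDiff ℝ ∞ φ) :
    Continuous (gradient φ) :=
  (InnerProductSpace.toDual ℝ (Space N)).symm.continuous.comp (hφ.continuous_fderiv (by simp))

/-- Cauchy–Schwarz, with the whole weight attached to `φ`. -/
lemma lintegral_weight_mul_le {N : ℕ} {φ : Space N → ℝ} (hφ : ContDiff ℝ ∞ φ) (s : Set (Space N))
    (β : ℝ) :
    ∫⁻ x in s, ENNReal.ofReal (‖x‖ ^ (-β)) * (2 * (‖φ x‖ₑ * ‖gradient φ x‖ₑ)) ≤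
      2 * (eLpNorm (fun x => ‖x‖ ^ (-β) * φ x) 2 (volume.restrict s) *
        eLpNorm (gradient φ) 2 volume) := by
  have hφc : Measurable φ := hφ.continuous.measurable
  have hgc : Measurable (gradient φ) := (continuous_gradient hφ).measurable
  have h1 := ENNReal.lintegral_mul_le_Lp_mul_Lq (volume.restrict s) Real.HolderConjugate.two_two
    (f := fun x => ‖‖x‖ ^ (-β) * φ x‖ₑ) (g := fun x => ‖gradient φ x‖ₑ)
    (by fun_prop) (by fun_prop)
  calc _ = 2 * ∫⁻ x in s, ((fun x => ‖‖x‖ ^ (-β) * φ x‖ₑ) * fun x => ‖gradient φ x‖ₑ) x := by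
        rw [← lintegral_const_mul _ (by fun_prop)]
        refine lintegral_congr fun x => ?_
        rw [← Real.enorm_of_nonneg (by positivity)]
        simp only [Pi.mul_apply, enorm_mul]
        ring
    _ ≤ _ := by
        gcongr
        refine h1.trans ?_
        rw [eLpNorm_eq_lintegral_rpow_enorm_toReal (by simp) (by simp),
          eLpNorm_eq_lintegral_rpow_enorm_toReal (by simp) (by simp)]
        simp only [ENNReal.toReal_ofNat]
        gcongr
        exact Measure.restrict_le_self

lemma lintegral_sq_eq {X F : Type*} [MeasurableSpace X] [NormedAddCommGroup F] (μ : Measure X)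
    (u : X → F) : ∫⁻ x, ‖u x‖ₑ ^ 2 ∂μ = eLpNorm u 2 μ ^ 2 := by
  rw [eLpNorm_eq_lintegral_rpow_enorm_toReal (by simp) (by simp), ← ENNReal.rpow_natCast,
    ← ENNReal.rpow_mul]
  simp

section

variable {N : ℕ}

lemma annulus_polar_aux [Nontrivial (Space N)] {a b β : ℝ} (h : Space N → ℝ≥0∞)
    (w : Metric.sphere (0 : Space N) 1) {r : ℝ} (hr : 0 < r) :
    ENNReal.ofReal (r ^ (Module.finrank ℝ (Space N) - 1)) *
      (annulus N a b).indicator (fun x => ENNReal.ofReal (‖x‖ ^ (-β)) * h x) (r • (w : Space N))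
    = (Set.Ioc a b).indicator
      (fun s => ENNReal.ofReal (s ^ ((N : ℝ) - 1 - β)) * h (s • (w : Space N))) r := by
  have hn : ‖r • (w : Space N)‖ = r := by simp [norm_smul, abs_of_pos hr]
  have hN : 1 ≤ N := by
    have := Module.finrank_pos (R := ℝ) (M := Space N)
    rwa [finrank_euclideanSpace_fin] at this
  by_cases hm : r ∈ Set.Ioc a b
  · have : r • (w : Space N) ∈ annulus N a b := by simpa [annulus, hn] using hm
    rw [Set.indicator_of_mem this, Set.indicator_of_mem hm, hn, ← mul_assoc,
      ← ENNReal.ofReal_mul (by positivity), finrank_euclideanSpace_fin, ← Real.rpow_natCast,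
      ← Real.rpow_add hr, Nat.cast_sub hN]
    simp [sub_eq_add_neg]
  · have : r • (w : Space N) ∉ annulus N a b := by simpa [annulus, hn] using hm
    rw [Set.indicator_of_notMem this, Set.indicator_of_notMem hm, mul_zero]

lemma lintegral_annulus [Nontrivial (Space N)] {a b β : ℝ} (ha : 0 ≤ a) {h : Space N → ℝ≥0∞} (hh : Measurable h) :
    ∫⁻ x in annulus N a b, ENNReal.ofReal (‖x‖ ^ (-β)) * h x =
    ∫⁻ w, (∫⁻ s in Set.Ioc a b, ENNReal.ofReal (s ^ ((N : ℝ) - 1 - β)) * h (s • (w : Space N)))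
      ∂(volume : Measure (Space N)).toSphere := by
  rw [← lintegral_indicator (measurableSet_annulus N a b), lintegral_polar]
  · refine lintegral_congr fun w => ?_
    rw [setLIntegral_congr_fun measurableSet_Ioi fun r hr => annulus_polar_aux h w hr,
      setLIntegral_indicator measurableSet_Ioc, Set.inter_eq_left.2]
    exact fun s hs => ha.trans_lt hs.1
  · exact Measurable.indicator (by fun_prop) (measurableSet_annulus N a b)

lemma lintegral_annulus_swap [Nontrivial (Space N)] {a b β : ℝ} (ha : 0 ≤ a) {h : Space N → ℝ≥0∞} (hh : Measurable h) :
    ∫⁻ x in annulus N a b, ENNReal.ofReal (‖x‖ ^ (-β)) * h x =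
    ∫⁻ s in Set.Ioc a b, ENNReal.ofReal (s ^ ((N : ℝ) - 1 - β)) *
      ∫⁻ w, h (s • (w : Space N)) ∂(volume : Measure (Space N)).toSphere := by
  have h3 : Measurable fun p : Metric.sphere (0 : Space N) 1 × ℝ =>
      ENNReal.ofReal (p.2 ^ ((N : ℝ) - 1 - β)) * h (p.2 • (p.1 : Space N)) := by fun_prop
  rw [lintegral_annulus ha hh, lintegral_lintegral_swap h3.aemeasurable]
  refine lintegral_congr fun r => ?_
  rw [lintegral_const_mul _ (by fun_prop)]

/-- `ray_estimate` is integrated over directions and over the outer radius `S ∈ (R, 2R]`, an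
interval of length `R`. Averaging in `S` replaces the value on one outer sphere by an annulus
integral, which passes to `L²` limits. -/
lemma sphere_estimate [Nontrivial (Space N)] {φ : Space N → ℝ} (hφ : ContDiff ℝ ∞ φ) {β r R : ℝ}
    (hβ : 0 < (N : ℝ) - 1 - β) (hr : 0 < r) (hrR : r ≤ R) :
    ENNReal.ofReal R * (ENNReal.ofReal (r ^ ((N : ℝ) - 1 - β)) *
      ∫⁻ w, ‖φ (r • (w : Space N))‖ₑ ^ 2 ∂(volume : Measure (Space N)).toSphere) ≤
    (∫⁻ x in annulus N R (2 * R), ENNReal.ofReal (‖x‖ ^ (-β)) * ‖φ x‖ₑ ^ 2) +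
    ENNReal.ofReal R * ∫⁻ x in annulus N r (2 * R),
      ENNReal.ofReal (‖x‖ ^ (-β)) * (2 * (‖φ x‖ₑ * ‖gradient φ x‖ₑ)) := by
  have hφc : Measurable φ := hφ.continuous.measurable
  have hgc : Measurable (gradient φ) := (continuous_gradient hφ).measurable
  have hR : 0 < R := hr.trans_le hrR
  set σ := (volume : Measure (Space N)).toSphere
  set B := ∫⁻ x in annulus N r (2 * R),
      ENNReal.ofReal (‖x‖ ^ (-β)) * (2 * (‖φ x‖ₑ * ‖gradient φ x‖ₑ)) with hB
  have h1 : ∀ S ∈ Set.Ioc R (2 * R), ENNReal.ofReal (r ^ ((N : ℝ) - 1 - β)) *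
      ∫⁻ w, ‖φ (r • (w : Space N))‖ₑ ^ 2 ∂σ ≤ ENNReal.ofReal (S ^ ((N : ℝ) - 1 - β)) *
      (∫⁻ w, ‖φ (S • (w : Space N))‖ₑ ^ 2 ∂σ) + B := by
    intro S hS
    rw [hB, lintegral_annulus hr.le (by fun_prop), ← lintegral_const_mul _ (by fun_prop),
      ← lintegral_const_mul _ (by fun_prop), ← lintegral_add_left (by fun_prop)]
    refine lintegral_mono fun w => ?_
    refine (ray_estimate hφ hβ hr (hrR.trans hS.1.le) (by simp : ‖(w : Space N)‖ = 1)).trans ?_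
    gcongr
    exact hS.2
  calc _ = ∫⁻ S in Set.Ioc R (2 * R), ENNReal.ofReal (r ^ ((N : ℝ) - 1 - β)) *
      ∫⁻ w, ‖φ (r • (w : Space N))‖ₑ ^ 2 ∂σ := by
        rw [setLIntegral_const, Real.volume_Ioc, mul_comm]; congr 2; ring
    _ ≤ ∫⁻ S in Set.Ioc R (2 * R), (ENNReal.ofReal (S ^ ((N : ℝ) - 1 - β)) *
      (∫⁻ w, ‖φ (S • (w : Space N))‖ₑ ^ 2 ∂σ) + B) := setLIntegral_mono' measurableSet_Ioc h1
    _ = _ := by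
        rw [lintegral_add_right _ measurable_const, setLIntegral_const, Real.volume_Ioc,
          lintegral_annulus_swap hR.le (by fun_prop), mul_comm B]
        congr 3; ring

/-- Mass on dyadic annuli of a function in `L^q`, or in a weighted `L²`. -/
lemma annulus_mass_bound (hN : 3 ≤ N) {β : ℝ} {u : Space N → ℝ}
    (hβ1 : β ≠ 1)
    (hu : MemLp u (ENNReal.ofReal (sobolevExp N)) volume)
    (hW : eLpNorm (fun x => ‖x‖ ^ (-β) * u x) 2 volume ≠ ⊤) (hβ0 : 0 < β) :
    ∃ C : ℝ≥0∞, C ≠ ⊤ ∧ ∀ R : ℝ, 0 < R →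
      ENNReal.ofReal (R ^ (-β)) * eLpNorm u 2 (volume.restrict (annulus N R (2 * R))) ^ 2 ≤
        ENNReal.ofReal R * (C * ENNReal.ofReal (R ^ (-|β - 1|))) := by
  have hN' : (3 : ℝ) ≤ N := by exact_mod_cast hN
  have hann : ∀ R : ℝ, ∀ᵐ x ∂(volume.restrict (annulus N R (2 * R))), x ∈ annulus N R (2 * R) :=
    fun R => ae_restrict_mem (measurableSet_annulus _ _ _)
  -- For `β < 1`, on the annulus `u² ≤ (2R)^{2β} |x|^{-2β} u²`, so the weighted norm gives `R^{-β}
  -- R^{2β} = R · R^{β-1}`.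
  rcases lt_or_gt_of_ne hβ1 with h | h
  · refine ⟨ENNReal.ofReal (2 ^ (2 * β)) * eLpNorm (fun x => ‖x‖ ^ (-β) * u x) 2 volume ^ 2,
      ENNReal.mul_ne_top (by simp) (by simp [hW]), fun R hR => ?_⟩
    have h1 : eLpNorm u 2 (volume.restrict (annulus N R (2 * R))) ≤
        ENNReal.ofReal ((2 * R) ^ β) * eLpNorm (fun x => ‖x‖ ^ (-β) * u x) 2 volume := by
      have : eLpNorm u 2 (volume.restrict (annulus N R (2 * R))) ≤
        eLpNorm (((2 * R) ^ β) • fun x => ‖x‖ ^ (-β) * u x) 2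
          (volume.restrict (annulus N R (2 * R))) := by
        refine eLpNorm_mono_ae ?_
        filter_upwards [hann R] with x hx
        have hx0 : 0 < ‖x‖ := hR.trans hx.1
        simp only [Pi.smul_apply, smul_eq_mul, norm_mul]
        rw [← mul_assoc]
        refine le_mul_of_one_le_left (norm_nonneg _) ?_
        rw [Real.norm_of_nonneg (by positivity), Real.norm_of_nonneg (by positivity),
          Real.rpow_neg hx0.le, ← div_eq_mul_inv, one_le_div (by positivity)]
        exact Real.rpow_le_rpow hx0.le hx.2 hβ0.le
      refine this.trans ?_
      rw [eLpNorm_const_smul, Real.enorm_of_nonneg (by positivity)]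
      gcongr
      exact Measure.restrict_le_self
    calc _ ≤ ENNReal.ofReal (R ^ (-β)) * (ENNReal.ofReal ((2 * R) ^ β) *
          eLpNorm (fun x => ‖x‖ ^ (-β) * u x) 2 volume) ^ 2 := by gcongr
      _ = ENNReal.ofReal (R ^ (-β) * ((2 * R) ^ β) ^ 2) *
          eLpNorm (fun x => ‖x‖ ^ (-β) * u x) 2 volume ^ 2 := by
          rw [ENNReal.ofReal_mul (by positivity), ENNReal.ofReal_pow (by positivity)]; ring
      _ = ENNReal.ofReal (R * (2 ^ (2 * β) * R ^ (-|β - 1|))) *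
          eLpNorm (fun x => ‖x‖ ^ (-β) * u x) 2 volume ^ 2 := by
          congr 2
          rw [abs_of_neg (by linarith), Real.mul_rpow (by norm_num) hR.le, mul_pow,
            ← Real.rpow_natCast, ← Real.rpow_natCast, ← Real.rpow_mul (by norm_num),
            ← Real.rpow_mul hR.le, mul_left_comm, ← Real.rpow_add hR, mul_left_comm]
          nth_rewrite 2 [← Real.rpow_one R]
          rw [← Real.rpow_add hR]
          congr 2
          · push_cast; ring
          · push_cast; ring
      _ = _ := by
          rw [ENNReal.ofReal_mul (by positivity), ENNReal.ofReal_mul (by positivity)]; ring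
  -- For `β > 1`, Hölder against `L^{2^*}` bounds the squared `L²` norm by a multiple of `R²`,
  -- giving `R^{-β} R² = R · R^{1-β}`. At `β = 1` neither bound would yield decay.
  · set S := eLpNorm u (ENNReal.ofReal (sobolevExp N)) volume with hS
    set v := volume (Metric.closedBall (0 : Space N) 1) with hv
    have hvt : v ≠ ⊤ := measure_closedBall_lt_top.ne
    have hpos : 0 < sobolevExp N := by
      rw [sobolevExp]; exact div_pos (by linarith) (by linarith)
    refine ⟨4 * S ^ 2 * v ^ (2 / (N : ℝ)), ?_, fun R hR => ?_⟩
    · exact ENNReal.mul_ne_top (ENNReal.mul_ne_top (by simp) (by simp [hS, hu.2.ne]))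
        (ENNReal.rpow_ne_top_of_nonneg (by positivity) hvt)
    have h2 : (2 : ℝ≥0∞) ≤ ENNReal.ofReal (sobolevExp N) := by
      rw [← ENNReal.ofReal_ofNat]
      refine ENNReal.ofReal_le_ofReal ?_
      rw [sobolevExp, le_div_iff₀ (by linarith)]
      linarith
    have h1 := eLpNorm_le_eLpNorm_mul_rpow_measure_univ (μ := volume.restrict (annulus N R (2 * R)))
      h2 hu.1.restrict
    have hexp : 1 / (2 : ℝ≥0∞).toReal - 1 / (ENNReal.ofReal (sobolevExp N)).toReal = 1 / (N : ℝ) := by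
      rw [ENNReal.toReal_ofReal hpos.le, sobolevExp, ENNReal.toReal_ofNat]
      have : (N : ℝ) - 2 ≠ 0 := by linarith
      field_simp
      ring
    have hvol : volume (annulus N R (2 * R)) ≤ ENNReal.ofReal ((2 * R) ^ N) * v := by
      have : annulus N R (2 * R) ⊆ Metric.closedBall 0 (2 * R) := fun x hx => by
        simpa using hx.2
      refine (measure_mono this).trans_eq ?_
      rw [Measure.addHaar_closedBall' _ _ (by positivity), finrank_euclideanSpace_fin]
    rw [hexp, Measure.restrict_apply_univ] at h1
    have h3 : (volume (annulus N R (2 * R)) ^ (1 / (N : ℝ))) ≤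
        ENNReal.ofReal (2 * R) * v ^ (1 / (N : ℝ)) := by
      refine (ENNReal.rpow_le_rpow hvol (by positivity)).trans_eq ?_
      rw [ENNReal.mul_rpow_of_nonneg _ _ (by positivity), ENNReal.ofReal_rpow_of_nonneg
        (by positivity) (by positivity), ← Real.rpow_natCast, ← Real.rpow_mul (by positivity)]
      have : (N : ℝ) ≠ 0 := by linarith
      simp [this]
    have h4 : eLpNorm u 2 (volume.restrict (annulus N R (2 * R))) ≤
        S * (ENNReal.ofReal (2 * R) * v ^ (1 / (N : ℝ))) := by
      refine h1.trans ?_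
      gcongr
      exact eLpNorm_mono_measure _ Measure.restrict_le_self
    calc _ ≤ ENNReal.ofReal (R ^ (-β)) * (S * (ENNReal.ofReal (2 * R) * v ^ (1 / (N : ℝ)))) ^ 2 := by
          gcongr
      _ = ENNReal.ofReal (R ^ (-β) * (2 * R) ^ 2) * (S ^ 2 * (v ^ (1 / (N : ℝ))) ^ 2) := by
          rw [ENNReal.ofReal_mul (p := R ^ (-β)) (by positivity), ENNReal.ofReal_pow (by positivity)]; ring
      _ = ENNReal.ofReal (R * (4 * R ^ (-|β - 1|))) * (S ^ 2 * v ^ (2 / (N : ℝ))) := by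
          rw [← ENNReal.rpow_natCast (v ^ _), ← ENNReal.rpow_mul]
          congr 2
          · rw [abs_of_pos (by linarith), neg_sub, Real.rpow_sub hR, Real.rpow_neg hR.le,
              Real.rpow_one]
            field_simp
            ring
          · congr 1
            push_cast; ring
      _ = _ := by
          rw [ENNReal.ofReal_mul (by positivity), ENNReal.ofReal_mul (by positivity)]
          simp only [ENNReal.ofReal_ofNat]
          ring

end

/-! ### Pointwise decay of radial functions. -/

section

variable {N : ℕ}

/-- Outside the ball of radius `r` the weight is bounded, so approximation errors in the weighted
norm reduce to plain `L²` errors. -/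
lemma eLpNorm_weight_le {v : Space N → ℝ} {r R β : ℝ} (hr : 0 < r) (hβ0 : 0 < β) :
    eLpNorm (fun x => ‖x‖ ^ (-β) * v x) 2 (volume.restrict (annulus N r R)) ≤
      ENNReal.ofReal (r ^ (-β)) * eLpNorm v 2 (volume.restrict (annulus N r R)) := by
  rw [← Real.enorm_of_nonneg (by positivity), ← eLpNorm_const_smul]
  refine eLpNorm_mono_ae ?_
  filter_upwards [ae_restrict_mem (measurableSet_annulus _ _ _)] with x hx
  have hx0 : 0 < ‖x‖ := hr.trans hx.1
  simp only [Pi.smul_apply, smul_eq_mul, norm_mul]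
  gcongr 1
  rw [Real.norm_of_nonneg (by positivity), Real.norm_of_nonneg (by positivity)]
  exact Real.rpow_le_rpow_of_nonpos hr hx.1.le (by linarith)

/-- `sphere_estimate` in terms of the distance of `φ` to `u`. -/
lemma sphere_estimate_perturbed [Nontrivial (Space N)] {φ u : Space N → ℝ} {G : Space N → Space N}
    (hφ : ContDiff ℝ ∞ φ) (hu : AEStronglyMeasurable u volume) (hG : AEStronglyMeasurable G volume)
    {β r R : ℝ} (hβ0 : 0 < β)
    (hβ : 0 < (N : ℝ) - 1 - β) (hr : 0 < r) (hrR : r ≤ R) :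
    ENNReal.ofReal R * (ENNReal.ofReal (r ^ ((N : ℝ) - 1 - β)) *
      ∫⁻ w, ‖φ (r • (w : Space N))‖ₑ ^ 2 ∂(volume : Measure (Space N)).toSphere) ≤
    ENNReal.ofReal (R ^ (-β)) * (eLpNorm u 2 (volume.restrict (annulus N R (2 * R))) +
      eLpNorm (φ - u) 2 (volume.restrict (annulus N r (2 * R)))) ^ 2 +
    ENNReal.ofReal R * (2 * ((eLpNorm (fun x => ‖x‖ ^ (-β) * u x) 2 volume +
      ENNReal.ofReal (r ^ (-β)) * eLpNorm (φ - u) 2 (volume.restrict (annulus N r (2 * R)))) *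
      (eLpNorm G 2 volume + eLpNorm (gradient φ - G) 2 volume))) := by
  have hR : 0 < R := hr.trans_le hrR
  have hφm : AEStronglyMeasurable φ volume := hφ.continuous.aestronglyMeasurable
  have hgm : AEStronglyMeasurable (gradient φ) volume :=
    (continuous_gradient hφ).aestronglyMeasurable
  refine (sphere_estimate hφ hβ hr hrR).trans ?_
  refine add_le_add ?_ ?_
  · calc _ ≤ ∫⁻ x in annulus N R (2 * R), ENNReal.ofReal (R ^ (-β)) * ‖φ x‖ₑ ^ 2 := by
          refine setLIntegral_mono' (measurableSet_annulus _ _ _) fun x hx => ?_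
          gcongr ENNReal.ofReal ?_ * _
          exact Real.rpow_le_rpow_of_nonpos hR hx.1.le (by linarith)
      _ = ENNReal.ofReal (R ^ (-β)) *
          eLpNorm φ 2 (volume.restrict (annulus N R (2 * R))) ^ 2 := by
          rw [lintegral_const_mul' _ _ ENNReal.ofReal_ne_top, lintegral_sq_eq]
      _ ≤ _ := by
          gcongr
          calc eLpNorm φ 2 (volume.restrict (annulus N R (2 * R))) =
              eLpNorm (u + (φ - u)) 2 (volume.restrict (annulus N R (2 * R))) := by
                rw [add_sub_cancel]
            _ ≤ _ := eLpNorm_add_le hu.restrict (hφm.sub hu).restrict one_le_two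
            _ ≤ _ := by
              gcongr
              exact fun x hx => ⟨hrR.trans_lt hx.1, hx.2⟩
  · gcongr
    refine (lintegral_weight_mul_le hφ _ _).trans ?_
    have hw : Measurable fun x : Space N => ‖x‖ ^ (-β) := by fun_prop
    gcongr
    · calc _ = eLpNorm ((fun x => ‖x‖ ^ (-β) * u x) + fun x => ‖x‖ ^ (-β) * (φ - u) x) 2
              (volume.restrict (annulus N r (2 * R))) := by
            congr 1
            ext x
            simp only [Pi.add_apply, Pi.sub_apply]
            ring
        _ ≤ _ := eLpNorm_add_le (hw.aestronglyMeasurable.mul hu.restrict)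
            (hw.aestronglyMeasurable.mul (hφm.sub hu).restrict) one_le_two
        _ ≤ _ := by
            gcongr
            · exact Measure.restrict_le_self
            · exact eLpNorm_weight_le hr hβ0
    · calc eLpNorm (gradient φ) 2 volume = eLpNorm (G + (gradient φ - G)) 2 volume := by
            rw [add_sub_cancel]
        _ ≤ _ := eLpNorm_add_le hG (hgm.sub hG) one_le_two

lemma two_lt_sobolevExp (hN : 3 ≤ N) : (2 : ℝ) < sobolevExp N := by
  have hN' : (3 : ℝ) ≤ N := by exact_mod_cast hN
  rw [sobolevExp, lt_div_iff₀ (by linarith)]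
  linarith

/-- Radial lemma: pointwise decay of radial functions of `D^{1,2}` with finite weighted `L²` norm. -/
lemma radial_decay [Nontrivial (Space N)] (hN : 3 ≤ N) {β : ℝ} (hβ0 : 0 < β) (hβ1 : β ≠ 1) (hβ : 0 < (N : ℝ) - 1 - β)
    {u : Space N → ℝ} {G : Space N → Space N} (hu : MemD12 N u G)
    (hW : eLpNorm (fun x => ‖x‖ ^ (-β) * u x) 2 volume ≠ ⊤)
    {g : ℝ → ℝ} (hg : u =ᵐ[volume] fun x => g ‖x‖) :
    ∀ᵐ x : Space N, ENNReal.ofReal (‖x‖ ^ ((N : ℝ) - 1 - β)) * (‖u x‖ₑ ^ 2 *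
      (volume : Measure (Space N)).toSphere Set.univ) ≤
      2 * (eLpNorm (fun x => ‖x‖ ^ (-β) * u x) 2 volume * eLpNorm G 2 volume) := by
  set σ := (volume : Measure (Space N)).toSphere with hσ
  obtain ⟨C, hC, hCb⟩ := annulus_mass_bound hN hβ1 hu.1 hW hβ0
  obtain ⟨huL, hGL, φ', hφ', hφu', hφG'⟩ := hu
  have h2s := two_lt_sobolevExp hN
  have hpos : ENNReal.ofReal (sobolevExp N) ≠ 0 := by
    simp only [ne_eq, ENNReal.ofReal_eq_zero, not_le]; linarith
  have hmeas : ∀ n, AEStronglyMeasurable (φ' n) volume :=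
    fun n => (hφ' n).1.continuous.aestronglyMeasurable
  obtain ⟨ns, hns, hae⟩ :=
    (tendstoInMeasure_of_tendsto_eLpNorm hpos hmeas huL.1 hφu').exists_seq_tendsto_ae
  set φ := fun n => φ' (ns n) with hφdef
  have hφ : ∀ n, ContDiff ℝ ∞ (φ n) := fun n => (hφ' _).1
  have hφu := hφu'.comp hns.tendsto_atTop
  have hφG := hφG'.comp hns.tendsto_atTop
  -- An annulus has finite volume and `2 < 2^*`, so convergence in `L^{2^*}` implies convergence in
  -- `L²` there.
  have hL2 : ∀ r R : ℝ, Tendsto (fun n => eLpNorm (φ n - u) 2 (volume.restrict (annulus N r R)))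
      atTop (𝓝 0) := by
    intro r R
    have hvol : volume (annulus N r R) ≠ ⊤ := by
      refine ne_top_of_le_ne_top (measure_closedBall_lt_top (x := (0 : Space N)) (r := R)).ne
        (measure_mono fun x hx => ?_)
      simpa using hx.2
    have h2 : (2 : ℝ≥0∞) ≤ ENNReal.ofReal (sobolevExp N) := by
      rw [← ENNReal.ofReal_ofNat]
      exact ENNReal.ofReal_le_ofReal h2s.le
    set c := (volume.restrict (annulus N r R) : Measure (Space N)) Set.univ ^
      (1 / (2 : ℝ≥0∞).toReal - 1 / (ENNReal.ofReal (sobolevExp N)).toReal) with hc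
    have hct : c ≠ ⊤ := by
      refine ENNReal.rpow_ne_top_of_nonneg ?_ (by simpa using hvol)
      rw [ENNReal.toReal_ofReal (by linarith), ENNReal.toReal_ofNat, sub_nonneg]
      exact one_div_le_one_div_of_le two_pos h2s.le
    have hlim := ENNReal.Tendsto.mul_const (b := c) hφu (Or.inr hct)
    rw [zero_mul] at hlim
    refine tendsto_of_tendsto_of_tendsto_of_le_of_le tendsto_const_nhds hlim
      (fun _ => zero_le) fun n => ?_
    refine (eLpNorm_le_eLpNorm_mul_rpow_measure_univ h2
      (((hmeas _).sub huL.1).restrict)).trans ?_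
    simp only [Function.comp]
    gcongr
    exact Measure.restrict_le_self
  set W := eLpNorm (fun x => ‖x‖ ^ (-β) * u x) 2 volume with hWd
  have hGt : eLpNorm G 2 volume ≠ ⊤ := hGL.2.ne
  have hgood : ∀ᵐ r : ℝ, 0 < r → ∀ᵐ w : Metric.sphere (0 : Space N) 1 ∂σ,
      Tendsto (fun n => φ n (r • (w : Space N))) atTop (𝓝 (g r)) := by
    have h1 : ∀ᵐ x : Space N, Tendsto (fun n => φ n x) atTop (𝓝 (g ‖x‖)) := by
      filter_upwards [hae, hg] with x h1 h2
      rwa [← h2]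
    filter_upwards [ae_sphere_of_ae volume h1] with r hr hr0
    filter_upwards [hr hr0] with w hw
    have hn : ‖r • (w : Space N)‖ = r := by simp [norm_smul, abs_of_pos hr0]
    rwa [hn] at hw
  have hfin : ∀ᵐ r : ℝ, 0 < r → ENNReal.ofReal (r ^ ((N : ℝ) - 1 - β)) *
      (‖g r‖ₑ ^ 2 * σ Set.univ) ≤ 2 * (W * eLpNorm G 2 volume) := by
    filter_upwards [hgood] with r hr hr0
    specialize hr hr0
    -- On a fixed sphere only pointwise convergence is known. Fatou gives the one inequality that is
    -- needed.
    have hfatou : ‖g r‖ₑ ^ 2 * σ Set.univ ≤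
        liminf (fun n => ∫⁻ w, ‖φ n (r • (w : Space N))‖ₑ ^ 2 ∂σ) atTop := by
      rw [← lintegral_const]
      refine le_trans (le_of_eq ?_) (lintegral_liminf_le fun n => ?_)
      · refine lintegral_congr_ae ?_
        filter_upwards [hr] with w hw
        exact ((ENNReal.continuous_pow 2).tendsto _ |>.comp hw.enorm).liminf_eq.symm
      · have := (hφ n).continuous.measurable
        fun_prop
    have hR : ∀ R, r ≤ R → ENNReal.ofReal (r ^ ((N : ℝ) - 1 - β)) * (‖g r‖ₑ ^ 2 * σ Set.univ) ≤
        C * ENNReal.ofReal (R ^ (-|β - 1|)) + 2 * (W * eLpNorm G 2 volume) := by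
      intro R hrR
      have hR0 : 0 < R := hr0.trans_le hrR
      have hRne : ENNReal.ofReal R ≠ 0 := by simpa using hR0
      have hlim : Tendsto (fun n =>
          ENNReal.ofReal (R ^ (-β)) * (eLpNorm u 2 (volume.restrict (annulus N R (2 * R))) +
            eLpNorm (φ n - u) 2 (volume.restrict (annulus N r (2 * R)))) ^ 2 +
          ENNReal.ofReal R * (2 * ((W +
            ENNReal.ofReal (r ^ (-β)) *
              eLpNorm (φ n - u) 2 (volume.restrict (annulus N r (2 * R)))) *
            (eLpNorm G 2 volume + eLpNorm (gradient (φ n) - G) 2 volume)))) atTop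
          (𝓝 (ENNReal.ofReal (R ^ (-β)) *
            (eLpNorm u 2 (volume.restrict (annulus N R (2 * R))) + 0) ^ 2 +
            ENNReal.ofReal R * (2 * ((W + ENNReal.ofReal (r ^ (-β)) * 0) *
              (eLpNorm G 2 volume + 0))))) := by
        refine Tendsto.add ?_ ?_
        · refine ENNReal.Tendsto.const_mul ?_ (Or.inr ENNReal.ofReal_ne_top)
          exact (ENNReal.continuous_pow 2).tendsto _ |>.comp
            (tendsto_const_nhds.add (hL2 r (2 * R)))
        · refine ENNReal.Tendsto.const_mul ?_ (Or.inr ENNReal.ofReal_ne_top)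
          refine ENNReal.Tendsto.const_mul ?_ (Or.inr (by simp))
          refine ENNReal.Tendsto.mul ?_ (Or.inr (by simpa using hGt)) ?_ (Or.inr (by simpa using hW))
          · refine tendsto_const_nhds.add ?_
            exact ENNReal.Tendsto.const_mul (hL2 r (2 * R)) (Or.inr ENNReal.ofReal_ne_top)
          · exact tendsto_const_nhds.add hφG
      simp only [add_zero, mul_zero] at hlim
      have h1 : ENNReal.ofReal R * (ENNReal.ofReal (r ^ ((N : ℝ) - 1 - β)) *
          (‖g r‖ₑ ^ 2 * σ Set.univ)) ≤ ENNReal.ofReal (R ^ (-β)) *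
            eLpNorm u 2 (volume.restrict (annulus N R (2 * R))) ^ 2 +
            ENNReal.ofReal R * (2 * (W * eLpNorm G 2 volume)) := by
        rw [← hlim.liminf_eq]
        calc _ ≤ ENNReal.ofReal R * (ENNReal.ofReal (r ^ ((N : ℝ) - 1 - β)) *
              liminf (fun n => ∫⁻ w, ‖φ n (r • (w : Space N))‖ₑ ^ 2 ∂σ) atTop) := by gcongr
          _ = liminf (fun n => ENNReal.ofReal R * (ENNReal.ofReal (r ^ ((N : ℝ) - 1 - β)) *
              ∫⁻ w, ‖φ n (r • (w : Space N))‖ₑ ^ 2 ∂σ)) atTop := by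
              rw [ENNReal.liminf_const_mul_of_ne_top ENNReal.ofReal_ne_top,
                ENNReal.liminf_const_mul_of_ne_top ENNReal.ofReal_ne_top]
          _ ≤ _ := by
              refine liminf_le_liminf (Eventually.of_forall fun n => ?_)
              exact sphere_estimate_perturbed (hφ n) huL.1 hGL.1 hβ0 hβ hr0 hrR
      -- `annulus_mass_bound` exposes a factor `R` in the boundary term. Cancelling it leaves `C
      -- R^{-|β-1|}`, which vanishes as `R → ∞`.
      have h2 := h1.trans (add_le_add_left (hCb R hR0) _)
      rw [← mul_add] at h2
      exact (ENNReal.mul_le_mul_iff_right hRne ENNReal.ofReal_ne_top).1 h2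
    have hlim : Tendsto (fun R : ℝ => C * ENNReal.ofReal (R ^ (-|β - 1|)) +
        2 * (W * eLpNorm G 2 volume)) atTop (𝓝 (C * ENNReal.ofReal 0 +
        2 * (W * eLpNorm G 2 volume))) := by
      refine Tendsto.add (ENNReal.Tendsto.const_mul (ENNReal.tendsto_ofReal ?_) (Or.inr hC))
        tendsto_const_nhds
      exact tendsto_rpow_neg_atTop (abs_pos.2 (sub_ne_zero.2 hβ1))
    simp only [ENNReal.ofReal_zero, mul_zero, zero_add] at hlim
    exact ge_of_tendsto hlim (eventually_atTop.2 ⟨r, hR⟩)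
  filter_upwards [ae_of_ae_norm volume hfin, hg] with x h1 h2
  rw [h2]
  exact h1

end

/-! ### Embeddings of the energy space, with the dependence on `A`. -/

section

variable {N : ℕ}

/-- The Sobolev inequality in `D^{1,2}`. -/
lemma sobolev_inequality (hN : 3 ≤ N) : ∃ S : ℝ, 0 < S ∧ ∀ (u : Space N → ℝ) (G : Space N → Space N),
    MemD12 N u G → eLpNorm u (ENNReal.ofReal (sobolevExp N)) volume ≤
      ENNReal.ofReal S * eLpNorm G 2 volume := by
  have hN' : (3 : ℝ) ≤ N := by exact_mod_cast hN
  have hs := two_lt_sobolevExp hN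
  set C := SNormLESNormFDerivOfEqConst ℝ (volume : Measure (Space N)) ((2 : NNReal) : ℝ) with hC
  -- Adding 1 to the Gagliardo–Nirenberg–Sobolev constant makes it strictly positive.
  refine ⟨C + 1, by positivity, fun u G hu => ?_⟩
  obtain ⟨huL, hGL, φ, hφ, hφu, hφG⟩ := hu
  have hGN : ∀ n, eLpNorm (φ n) (ENNReal.ofReal (sobolevExp N)) volume ≤
      ENNReal.ofReal (C + 1) * eLpNorm (gradient (φ n)) 2 volume := by
    intro n
    have h1 := eLpNorm_le_eLpNorm_fderiv_of_eq (F := ℝ) (volume : Measure (Space N)) (u := φ n)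
      (p := 2) (p' := (sobolevExp N).toNNReal) ((hφ n).1.of_le (by simp)) (hφ n).2 one_le_two
      (by rw [finrank_euclideanSpace_fin]; omega) (by
        rw [finrank_euclideanSpace_fin, Real.coe_toNNReal _ (by linarith), sobolevExp]
        have : (N : ℝ) - 2 ≠ 0 := by linarith
        push_cast
        field_simp
        )
    have h2 : eLpNorm (gradient (φ n)) 2 volume = eLpNorm (fderiv ℝ (φ n)) 2 volume :=
      eLpNorm_congr_norm_ae (Eventually.of_forall fun x => by simp [gradient])
    rw [h2]
    refine h1.trans ?_
    gcongr
    · rw [← ENNReal.ofReal_coe_nnreal]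
      exact ENNReal.ofReal_le_ofReal (by linarith)
    · exact le_of_eq rfl
  have hp1 : 1 ≤ ENNReal.ofReal (sobolevExp N) := by
    rw [ENNReal.one_le_ofReal]; linarith
  have hb : ∀ n, eLpNorm u (ENNReal.ofReal (sobolevExp N)) volume ≤
      eLpNorm (φ n - u) (ENNReal.ofReal (sobolevExp N)) volume +
      ENNReal.ofReal (C + 1) * (eLpNorm G 2 volume + eLpNorm (gradient (φ n) - G) 2 volume) := by
    intro n
    have hm : AEStronglyMeasurable (φ n) volume := (hφ n).1.continuous.aestronglyMeasurable
    have hgm : AEStronglyMeasurable (gradient (φ n)) volume :=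
      (continuous_gradient (hφ n).1).aestronglyMeasurable
    calc _ = eLpNorm ((u - φ n) + φ n) (ENNReal.ofReal (sobolevExp N)) volume := by
          rw [sub_add_cancel]
      _ ≤ _ := eLpNorm_add_le (huL.1.sub hm) hm hp1
      _ ≤ _ := by
        rw [eLpNorm_sub_comm]
        gcongr
        refine (hGN n).trans ?_
        gcongr
        calc eLpNorm (gradient (φ n)) 2 volume = eLpNorm (G + (gradient (φ n) - G)) 2 volume := by
              rw [add_sub_cancel]
          _ ≤ _ := eLpNorm_add_le hGL.1 (hgm.sub hGL.1) one_le_two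
  have hlim := hφu.add (ENNReal.Tendsto.const_mul (a := ENNReal.ofReal (C + 1))
    ((tendsto_const_nhds (x := eLpNorm G 2 volume)).add hφG) (Or.inr ENNReal.ofReal_ne_top))
  rw [zero_add, add_zero] at hlim
  exact ge_of_tendsto' hlim hb

lemma ae_of_ae_potMeasure (hN : 3 ≤ N) {α A : ℝ} (hA : 0 < A) {P : Space N → Prop}
    (h : ∀ᵐ x ∂(potMeasure N α A), P x) : ∀ᵐ x : Space N, P x := by
  have : Nonempty (Fin N) := ⟨⟨0, by omega⟩⟩
  rw [potMeasure, ae_withDensity_iff (by fun_prop)] at h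
  have h0 : ∀ᵐ x : Space N, x ≠ 0 := by simp [ae_iff]
  filter_upwards [h, h0] with x hx hx0
  refine hx ?_
  have : 0 < ‖x‖ := norm_pos_iff.2 hx0
  simp only [ne_eq, ENNReal.ofReal_eq_zero, not_le]
  positivity

lemma MemD12.congr_fun {u u' : Space N → ℝ} {G : Space N → Space N}
    (h : MemD12 N u G) (hu : u =ᵐ[volume] u') : MemD12 N u' G := by
  obtain ⟨h1, h2, φ, h3, h4, h5⟩ := h
  refine ⟨(memLp_congr_ae hu).1 h1, h2, φ, h3, ?_, h5⟩
  refine h4.congr fun n => eLpNorm_congr_ae ?_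
  filter_upwards [hu] with x hx
  simp [hx]

variable {α A : ℝ}

lemma memD12_toFun (hN : 3 ≤ N) (hA : 0 < A) (w : energySpace N α A) :
    MemD12 N (toFun w) (grad w) := by
  obtain ⟨u, hu, hu'⟩ := w.2
  exact hu.congr_fun (ae_of_ae_potMeasure hN hA hu')

lemma measurable_toFun (w : energySpace N α A) : Measurable (toFun w) :=
  (Lp.stronglyMeasurable _).measurable

lemma toFun_smul (hN : 3 ≤ N) (hA : 0 < A) (t : ℝ) (w : energySpace N α A) :
    toFun (t • w) =ᵐ[volume] fun x => t * toFun w x :=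
  ae_of_ae_potMeasure hN hA (Lp.coeFn_smul _ _)

lemma eLpNorm_grad_le (w : energySpace N α A) :
    eLpNorm (grad w) 2 volume ≤ ENNReal.ofReal ‖w‖ := by
  rw [grad, ← Lp.enorm_def, ← ofReal_norm]
  exact ENNReal.ofReal_le_ofReal (WithLp.norm_fst_le _ _)

/-- The potential part of the norm is exactly `A^{1/2}` times the weighted norm. All powers of `A`
in the final bound originate here. -/
lemma eLpNorm_weight_toFun_le (hA : 0 < A) (w : energySpace N α A) :
    eLpNorm (fun x => ‖x‖ ^ (-(α / 2)) * toFun w x) 2 volume ≤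
      ENNReal.ofReal (A ^ (-(1 / 2) : ℝ) * ‖w‖) := by
  have h1 : eLpNorm (toFun w) 2 (potMeasure N α A) ≤ ENNReal.ofReal ‖w‖ := by
    rw [toFun, ← Lp.enorm_def, ← ofReal_norm]
    exact ENNReal.ofReal_le_ofReal (WithLp.norm_snd_le _ _)
  have hm := measurable_toFun w
  have h2 : eLpNorm (toFun w) 2 (potMeasure N α A) ^ 2 =
      (ENNReal.ofReal (A ^ (1 / 2 : ℝ)) *
        eLpNorm (fun x => ‖x‖ ^ (-(α / 2)) * toFun w x) 2 volume) ^ 2 := by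
    rw [← Real.enorm_of_nonneg (by positivity), ← eLpNorm_const_smul, ← lintegral_sq_eq,
      ← lintegral_sq_eq, potMeasure, lintegral_withDensity_eq_lintegral_mul _ (by fun_prop)
      (by fun_prop)]
    refine lintegral_congr fun x => ?_
    simp only [Pi.mul_apply, Pi.smul_apply, smul_eq_mul, enorm_mul]
    have e : ENNReal.ofReal (A / ‖x‖ ^ α) =
        (‖A ^ (1 / 2 : ℝ)‖ₑ * ‖‖x‖ ^ (-(α / 2))‖ₑ) ^ 2 := by
      have e0 : 0 ≤ A ^ (1 / 2 : ℝ) * ‖x‖ ^ (-(α / 2)) := by positivity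
      rw [← enorm_mul, Real.enorm_of_nonneg e0, ← ENNReal.ofReal_pow e0, mul_pow,
        ← Real.rpow_natCast, ← Real.rpow_natCast, ← Real.rpow_mul hA.le,
        ← Real.rpow_mul (norm_nonneg _), div_eq_mul_inv, ← Real.rpow_neg (norm_nonneg _)]
      congr 2
      · norm_num
      · congr 1; push_cast; ring
    rw [e]
    ring
  rw [ENNReal.pow_right_strictMono two_ne_zero |>.injective.eq_iff] at h2
  rw [h2] at h1
  have h3 : ENNReal.ofReal (A ^ (-(1 / 2) : ℝ)) * ENNReal.ofReal (A ^ (1 / 2 : ℝ)) = 1 := by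
    rw [← ENNReal.ofReal_mul (by positivity), ← Real.rpow_add hA]
    simp
  calc _ = ENNReal.ofReal (A ^ (-(1 / 2) : ℝ)) * (ENNReal.ofReal (A ^ (1 / 2 : ℝ)) *
        eLpNorm (fun x => ‖x‖ ^ (-(α / 2)) * toFun w x) 2 volume) := by
        rw [← mul_assoc, h3, one_mul]
    _ ≤ _ := by
        rw [ENNReal.ofReal_mul (by positivity)]
        gcongr

/-- Radial functions of `H^1_α` are in `L^{2^*_α}`. -/
lemma lintegral_radialExp_le (hN : 3 ≤ N) (hα0 : 0 < α) (hα : α < 2 * (N : ℝ) - 2) (hα2 : α ≠ 2) :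
    ∃ C : ℝ, 0 < C ∧ ∀ A : ℝ, 0 < A → ∀ w : energySpace N α A, IsRadial w →
      ∫⁻ x, ENNReal.ofReal (|toFun w x| ^ radialExp N α) ≤
        ENNReal.ofReal (C * A ^ (-(2 * ((N : ℝ) - 1) / (2 * N - 2 - α))) *
          ‖w‖ ^ radialExp N α) := by
  have : Nonempty (Fin N) := ⟨⟨0, by omega⟩⟩
  have hγ0 : 0 < 2 * (N : ℝ) - 2 - α := by linarith
  have hγ : 0 < (N : ℝ) - 1 - α / 2 := by linarith
  set γ := (N : ℝ) - 1 - α / 2 with hγd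
  set s := (volume : Measure (Space N)).toSphere.real Set.univ with hs
  have hs0 : 0 < s := by
    rw [hs, measureReal_def, ENNReal.toReal_pos_iff]
    exact ⟨by rw [Measure.measure_univ_pos]; exact Measure.toSphere_ne_zero _,
      measure_lt_top _ _⟩
  have hq : radialExp N α = 2 + 2 * (α / γ) := by
    have e1 : 2 * (N : ℝ) - 2 - α = 2 * γ := by rw [hγd]; ring
    have e2 : 2 * (N : ℝ) - 2 + α = 2 * γ + 2 * α := by rw [hγd]; ring
    rw [radialExp, e1, e2]
    field_simp
  refine ⟨(2 / s) ^ (α / γ), by positivity, fun A hA w hw => ?_⟩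
  obtain ⟨g, hg⟩ := hw
  set E := ‖w‖ with hE
  have hE0 : 0 ≤ E := norm_nonneg _
  have hWle := eLpNorm_weight_toFun_le hA w
  have hdec := radial_decay hN (β := α / 2) (by positivity) (by intro h; apply hα2; linarith) hγ
    (memD12_toFun hN hA w) (ne_top_of_le_ne_top ENNReal.ofReal_ne_top hWle) hg
  set K := 2 / s * (A ^ (-(1 / 2) : ℝ) * E * E) with hK
  have hK0 : 0 ≤ K := by positivity
  -- Write `2^*_α = 2 + 2α/γ` and apply the decay `u² ≤ K |x|^{-γ}` to the factor `(u²)^{α/γ}`. It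
  -- produces exactly the weight `|x|^{-α}` of the potential.
  have hpt : ∀ᵐ x : Space N, |toFun w x| ^ radialExp N α ≤
      K ^ (α / γ) * (‖x‖ ^ (-(α / 2)) * toFun w x) ^ 2 := by
    have h0 : ∀ᵐ x : Space N, x ≠ 0 := by simp [ae_iff]
    filter_upwards [hdec, h0] with x hx hx0
    have hx0 : 0 < ‖x‖ := norm_pos_iff.2 hx0
    have h1 : ‖x‖ ^ γ * (|toFun w x| ^ 2 * s) ≤ 2 * (A ^ (-(1 / 2) : ℝ) * E * E) := by
      have h2 : ENNReal.ofReal (‖x‖ ^ γ) * (‖toFun w x‖ₑ ^ 2 *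
          (volume : Measure (Space N)).toSphere Set.univ) ≤ ENNReal.ofReal 2 *
          (ENNReal.ofReal (A ^ (-(1 / 2) : ℝ) * E) * ENNReal.ofReal E) := by
        rw [ENNReal.ofReal_ofNat]
        exact hx.trans (mul_le_mul_right (mul_le_mul' hWle (eLpNorm_grad_le w)) 2)
      rw [← ENNReal.ofReal_toReal (measure_ne_top _ Set.univ), ← measureReal_def, ← hs,
        Real.enorm_eq_ofReal_abs, ← ENNReal.ofReal_pow (abs_nonneg _),
        ← ENNReal.ofReal_mul (by positivity), ← ENNReal.ofReal_mul (by positivity),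
        ← ENNReal.ofReal_mul (by positivity), 
        ← ENNReal.ofReal_mul (by positivity), ENNReal.ofReal_le_ofReal_iff (by positivity)] at h2
      exact h2
    have h2 : |toFun w x| ^ 2 ≤ K * ‖x‖ ^ (-γ) := by
      rw [Real.rpow_neg hx0.le, ← div_eq_mul_inv, le_div_iff₀ (by positivity), hK,
        div_mul_eq_mul_div, le_div_iff₀ hs0]
      linarith
    calc |toFun w x| ^ radialExp N α = |toFun w x| ^ 2 * (|toFun w x| ^ 2) ^ (α / γ) := by
          rw [hq, Real.rpow_add_of_nonneg (abs_nonneg _) (by norm_num) (by positivity),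
            Real.rpow_mul (abs_nonneg _)]
          norm_cast
      _ ≤ |toFun w x| ^ 2 * (K * ‖x‖ ^ (-γ)) ^ (α / γ) := by gcongr
      _ = _ := by
          rw [Real.mul_rpow hK0 (by positivity), ← Real.rpow_mul hx0.le, mul_pow, sq_abs,
            ← Real.rpow_natCast (‖x‖ ^ _), ← Real.rpow_mul hx0.le]
          have e1 : -γ * (α / γ) = -α := by field_simp
          have e2 : -(α / 2) * ((2 : ℕ) : ℝ) = -α := by push_cast; ring
          rw [e1, e2]
          ring
  calc _ ≤ ∫⁻ x, ENNReal.ofReal (K ^ (α / γ)) * ‖‖x‖ ^ (-(α / 2)) * toFun w x‖ₑ ^ 2 := by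
        refine lintegral_mono_ae ?_
        filter_upwards [hpt] with x hx
        rw [Real.enorm_eq_ofReal_abs, ← ENNReal.ofReal_pow (abs_nonneg _), sq_abs,
          ← ENNReal.ofReal_mul (by positivity)]
        exact ENNReal.ofReal_le_ofReal hx
    _ = ENNReal.ofReal (K ^ (α / γ)) *
        eLpNorm (fun x => ‖x‖ ^ (-(α / 2)) * toFun w x) 2 volume ^ 2 := by
        rw [lintegral_const_mul' _ _ ENNReal.ofReal_ne_top, lintegral_sq_eq]
    _ ≤ ENNReal.ofReal (K ^ (α / γ)) * ENNReal.ofReal (A ^ (-(1 / 2) : ℝ) * E) ^ 2 := by gcongr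
    _ = _ := by
        rw [← ENNReal.ofReal_pow (by positivity), ← ENNReal.ofReal_mul (by positivity)]
        congr 1
        have hδ : 0 ≤ α / γ := by positivity
        have e1 : (A ^ (-(1 / 2) : ℝ)) ^ (α / γ) * (A ^ (-(1 / 2) : ℝ)) ^ 2 =
            A ^ (-(2 * ((N : ℝ) - 1) / (2 * N - 2 - α))) := by
          rw [← Real.rpow_mul hA.le, ← Real.rpow_natCast, ← Real.rpow_mul hA.le,
            ← Real.rpow_add hA]
          congr 1
          have e1 : 2 * (N : ℝ) - 2 - α = 2 * γ := by rw [hγd]; ring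
          have e2 : (N : ℝ) - 1 = γ + α / 2 := by rw [hγd]; ring
          rw [e1, e2]
          push_cast
          field_simp
          ring
        have e2 : (E * E) ^ (α / γ) * E ^ 2 = E ^ radialExp N α := by
          rw [← pow_two, ← Real.rpow_natCast, ← Real.rpow_mul hE0,
            ← Real.rpow_add_of_nonneg hE0 (by positivity) (by positivity), hq]
          congr 1
          push_cast; ring
        rw [hK, Real.mul_rpow (by positivity) (by positivity), mul_assoc (A ^ _),
          Real.mul_rpow (by positivity) (by positivity), mul_pow, ← e1, ← e2]
        ring

/-- Only the gradient part of the norm is used, hence a constant uniform in `α` and `A`. -/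
lemma lintegral_sobolevExp_le (hN : 3 ≤ N) :
    ∃ C : ℝ, 0 < C ∧ ∀ α A : ℝ, 0 < A → ∀ w : energySpace N α A,
      ∫⁻ x, ENNReal.ofReal (|toFun w x| ^ sobolevExp N) ≤
        ENNReal.ofReal (C * ‖w‖ ^ sobolevExp N) := by
  obtain ⟨S, hS, h⟩ := sobolev_inequality hN
  have hs := two_lt_sobolevExp hN
  refine ⟨S ^ sobolevExp N, by positivity, fun α A hA w => ?_⟩
  have h1 := (h _ _ (memD12_toFun hN hA w)).trans (mul_le_mul_right (eLpNorm_grad_le w) _)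
  rw [eLpNorm_eq_lintegral_rpow_enorm_toReal (by simp; linarith) ENNReal.ofReal_ne_top,
    ENNReal.toReal_ofReal (by linarith), ← ENNReal.ofReal_mul hS.le, one_div,
    ENNReal.rpow_inv_le_iff (by linarith), ENNReal.ofReal_rpow_of_nonneg (by positivity)
    (by linarith), Real.mul_rpow hS.le (norm_nonneg _)] at h1
  refine le_trans (le_of_eq (lintegral_congr fun x => ?_)) h1
  rw [Real.enorm_eq_ofReal_abs, ENNReal.ofReal_rpow_of_nonneg (abs_nonneg _) (by linarith)]

/-- Here `m = N-2`, `a = α-2` and `d = 2N-2-α`. The power of `A` in the `L^{2^*_α}` bound,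
multiplied by the interpolation parameter `t`, is rewritten in terms of `p - 2^*`. -/
lemma radial_exponent_identity {m a d t : ℝ} (hm : m ≠ 0) (ha : a ≠ 0) (hd0 : d ≠ 0)
    (hd : d = 2 * m - a) :
    -(2 * (m + 1) / d) * t = -(m * (t * (2 * ((2 * m + a + 4) / d)) +
      (1 - t) * (2 * (m + 2) / m) - 2 * (m + 2) / m) / (2 * a)) := by
  field_simp
  rw [hd]
  ring

/-- Interpolated embedding of the radial subspace, with the dependence on `A`. -/
lemma lintegral_rpow_le (hN : 3 ≤ N) (hα0 : 0 < α) (hα : α < 2 * (N : ℝ) - 2) (hα2 : α ≠ 2)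
    {p t : ℝ} (ht0 : 0 ≤ t) (ht1 : t ≤ 1)
    (hp : p = t * radialExp N α + (1 - t) * sobolevExp N) :
    ∃ C : ℝ, 0 < C ∧ ∀ A : ℝ, 0 < A → ∀ w : energySpace N α A, IsRadial w →
      ∫⁻ x, ENNReal.ofReal (|toFun w x| ^ p) ≤
        ENNReal.ofReal (C * A ^ (-(((N : ℝ) - 2) * (p - sobolevExp N) / (2 * (α - 2)))) *
          ‖w‖ ^ p) := by
  have hN' : (3 : ℝ) ≤ N := by exact_mod_cast hN
  obtain ⟨C₁, hC₁, h₁⟩ := lintegral_radialExp_le hN hα0 hα hα2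
  obtain ⟨C₂, hC₂, h₂⟩ := lintegral_sobolevExp_le hN
  have hs := two_lt_sobolevExp hN
  have hγ0 : 0 < 2 * (N : ℝ) - 2 - α := by linarith
  have hq0 : 0 < radialExp N α := by
    rw [radialExp]
    have : 0 < 2 * (N : ℝ) - 2 + α := by linarith
    positivity
  refine ⟨C₁ ^ t * C₂ ^ (1 - t), by positivity, fun A hA w hw => ?_⟩
  have ht1' : 0 ≤ 1 - t := by linarith
  have hm := measurable_toFun w
  have hs0 : 0 ≤ sobolevExp N := by linarith
  have hqt : 0 ≤ radialExp N α * t := by positivity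
  have hst : 0 ≤ sobolevExp N * (1 - t) := by positivity
  have split : ∀ y : ℝ, 0 ≤ y → (y ^ radialExp N α) ^ t * (y ^ sobolevExp N) ^ (1 - t) = y ^ p := by
    intro y hy
    rw [← Real.rpow_mul hy, ← Real.rpow_mul hy, ← Real.rpow_add_of_nonneg hy hqt hst, hp]
    congr 1; ring
  have h3 := ENNReal.lintegral_mul_norm_pow_le (μ := volume)
    (f := fun x => ENNReal.ofReal (|toFun w x| ^ radialExp N α))
    (g := fun x => ENNReal.ofReal (|toFun w x| ^ sobolevExp N)) (by fun_prop) (by fun_prop)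
    ht0 ht1' (by ring)
  calc _ = ∫⁻ x, ENNReal.ofReal (|toFun w x| ^ radialExp N α) ^ t *
        ENNReal.ofReal (|toFun w x| ^ sobolevExp N) ^ (1 - t) := by
        refine lintegral_congr fun x => ?_
        rw [ENNReal.ofReal_rpow_of_nonneg (by positivity) ht0,
          ENNReal.ofReal_rpow_of_nonneg (by positivity) ht1', ← ENNReal.ofReal_mul (by positivity),
          split _ (abs_nonneg _)]
    _ ≤ _ := h3
    _ ≤ _ := mul_le_mul' (ENNReal.rpow_le_rpow (h₁ A hA w hw) ht0)
        (ENNReal.rpow_le_rpow (h₂ α A hA w) ht1')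
    _ = _ := by
        rw [ENNReal.ofReal_rpow_of_nonneg (by positivity) ht0,
          ENNReal.ofReal_rpow_of_nonneg (by positivity) ht1', ← ENNReal.ofReal_mul (by positivity),
          Real.mul_rpow (by positivity) (by positivity), Real.mul_rpow (by positivity) (by positivity),
          Real.mul_rpow (by positivity) (by positivity), ← split _ (norm_nonneg w),
          ← Real.rpow_mul hA.le]
        have e : -(2 * ((N : ℝ) - 1) / (2 * N - 2 - α)) * t =
            -(((N : ℝ) - 2) * (p - sobolevExp N) / (2 * (α - 2))) := by
          have h2 : (N : ℝ) - 2 ≠ 0 := by linarith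
          have h4 : α - 2 ≠ 0 := sub_ne_zero.2 hα2
          have h5 := radial_exponent_identity h2 h4 hγ0.ne' (t := t) (by ring)
          rw [hp, radialExp, sobolevExp]
          convert h5 using 3 <;> ring
        rw [e]
        congr 1
        ring

end

/-! ### Growth and convexity properties of the nonlinearity. -/

section Nonlinearity

variable {f : ℝ → ℝ}

lemma eq_zero_of_nonpos (hf : Continuous f) (hneg : ∀ s : ℝ, s < 0 → f s = 0) {s : ℝ}
    (hs : s ≤ 0) : f s = 0 := by
  have h : Set.EqOn f 0 (closure (Set.Iio 0)) :=
    Set.EqOn.closure (fun s hs => hneg s hs) hf continuous_const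
  rw [closure_Iio] at h
  exact h hs

lemma min_rpow_le {p₁ p₂ q s : ℝ} (h1 : p₁ ≤ q) (h2 : q ≤ p₂) (hs : 0 < s) :
    min (s ^ p₁) (s ^ p₂) ≤ s ^ q := by
  rcases le_total s 1 with h | h
  · exact (min_le_right _ _).trans (Real.rpow_le_rpow_of_exponent_ge hs h h2)
  · exact (min_le_left _ _).trans (Real.rpow_le_rpow_of_exponent_le h h1)

/-- The minimum of two powers lies below every intermediate power. The freedom in `q` matters: `q =
2^*` gives integrability on the whole energy space, `q = p` the quantitative bound. -/
lemma abs_le_rpow (hf : Continuous f) (hneg : ∀ s : ℝ, s < 0 → f s = 0) {M p₁ p₂ q : ℝ}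
    (hM : 0 < M) (hg : ∀ s : ℝ, 0 < s → 0 < f s ∧ f s ≤ M * min (s ^ (p₁ - 1)) (s ^ (p₂ - 1)))
    (h1 : p₁ ≤ q) (h2 : q ≤ p₂) (s : ℝ) : |f s| ≤ M * |s| ^ (q - 1) := by
  rcases le_or_gt s 0 with hs | hs
  · rw [eq_zero_of_nonpos hf hneg hs, abs_zero]
    positivity
  · rw [abs_of_pos (hg s hs).1, abs_of_pos hs]
    refine (hg s hs).2.trans ?_
    gcongr
    exact min_rpow_le (by linarith) (by linarith) hs

lemma hasDerivAt_primitive (hf : Continuous f) (s : ℝ) : HasDerivAt (primitive f) (f s) s :=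
  intervalIntegral.integral_hasDerivAt_right (hf.intervalIntegrable _ _)
    hf.aestronglyMeasurable.stronglyMeasurableAtFilter hf.continuousAt

lemma continuous_primitive (hf : Continuous f) : Continuous (primitive f) :=
  continuous_iff_continuousAt.2 fun s => (hasDerivAt_primitive hf s).continuousAt

lemma primitive_of_nonpos (hf : Continuous f) (hneg : ∀ s : ℝ, s < 0 → f s = 0) {s : ℝ}
    (hs : s ≤ 0) : primitive f s = 0 := by
  rw [primitive, intervalIntegral.integral_symm, intervalIntegral.integral_of_le hs,
    setIntegral_eq_zero_of_forall_eq_zero fun t ht => eq_zero_of_nonpos hf hneg ht.2, neg_zero]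

lemma abs_primitive_le (hf : Continuous f) (hneg : ∀ s : ℝ, s < 0 → f s = 0) {M p₁ p₂ q : ℝ}
    (hM : 0 < M) (hg : ∀ s : ℝ, 0 < s → 0 < f s ∧ f s ≤ M * min (s ^ (p₁ - 1)) (s ^ (p₂ - 1)))
    (h1 : p₁ ≤ q) (h2 : q ≤ p₂) (hq : 1 ≤ q) (s : ℝ) : |primitive f s| ≤ M * |s| ^ q := by
  have h := intervalIntegral.norm_integral_le_of_norm_le_const (a := 0) (b := s) (f := f)
    (C := M * |s| ^ (q - 1)) fun t ht => by
      refine (abs_le_rpow hf hneg hM hg h1 h2 t).trans ?_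
      have : |t| ≤ |s| := by
        rcases le_total 0 s with hs | hs
        · rw [Set.uIoc_of_le hs] at ht
          rw [abs_of_pos ht.1, abs_of_nonneg hs]
          exact ht.2
        · rw [Set.uIoc_of_ge hs] at ht
          rw [abs_of_nonpos ht.2, abs_of_nonpos hs]
          linarith [ht.1]
      gcongr
  rw [sub_zero, mul_assoc] at h
  refine h.trans (le_of_eq ?_)
  congr 1
  rcases eq_or_ne s 0 with rfl | hs
  · simp; rw [Real.zero_rpow (by linarith)]
  · rw [← Real.rpow_add_one (abs_pos.2 hs).ne', sub_add_cancel]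

/-- Monotonicity of `f(s)/s` compares the increments of the primitive with those of a parabola. -/
lemma primitive_sub_ge (hf : Continuous f) (hneg : ∀ s : ℝ, s < 0 → f s = 0)
    (h1 : MonotoneOn (fun s : ℝ => f s / s) (Set.Ioi 0)) {t : ℝ} (ht : 0 ≤ t) (s : ℝ) :
    (t ^ 2 - 1) / 2 * (f s * s) ≤ primitive f (t * s) - primitive f s := by
  rcases le_or_gt s 0 with hs | hs
  · rw [eq_zero_of_nonpos hf hneg hs, primitive_of_nonpos hf hneg hs,
      primitive_of_nonpos hf hneg (mul_nonpos_of_nonneg_of_nonpos ht hs)]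
    simp
  set c := f s / s with hc
  have hcs : f s = c * s := by rw [hc, div_mul_cancel₀ _ hs.ne']
  have hi : ∀ a b : ℝ, IntervalIntegrable f volume a b := fun a b => hf.intervalIntegrable a b
  have hj : ∀ a b : ℝ, IntervalIntegrable (fun x => c * x) volume a b :=
    fun a b => Continuous.intervalIntegrable (by fun_prop) a b
  have e : primitive f (t * s) - primitive f s = ∫ x in s..(t * s), f x :=
    intervalIntegral.integral_interval_sub_left (hi _ _) (hi _ _)
  have e2 : ∫ x in s..(t * s), c * x = (t ^ 2 - 1) / 2 * (f s * s) := by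
    rw [intervalIntegral.integral_const_mul, integral_id, hcs]
    ring
  rw [e, ← e2]
  -- Compared with the line `c x` through `(s, f(s))`, `f` lies above it beyond `s` and below it on
  -- `[0, s]`. For `t ≤ 1` the orientation of the integral reverses too, so both cases give the same
  -- inequality.
  rcases le_total 1 t with h | h
  · refine intervalIntegral.integral_mono_on (by nlinarith) (hj _ _) (hi _ _) fun x hx => ?_
    have hx0 : 0 < x := hs.trans_le hx.1
    exact (le_div_iff₀ hx0).1 (h1 hs hx0 hx.1)
  · rw [intervalIntegral.integral_symm, intervalIntegral.integral_symm (t * s) s, neg_le_neg_iff]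
    refine intervalIntegral.integral_mono_on (by nlinarith) (hi _ _) (hj _ _) fun x hx => ?_
    rcases (le_trans (mul_nonneg ht hs.le) hx.1).eq_or_lt with hx0 | hx0
    · rw [← hx0, eq_zero_of_nonpos hf hneg le_rfl, mul_zero]
    · exact (div_le_iff₀ hx0).1 (h1 hx0 hs hx.2)

end Nonlinearity

/-! ### The energy along rays through a critical point. -/

section Energy

variable {N : ℕ} {α A : ℝ} {f : ℝ → ℝ} {M p₁ p₂ : ℝ}

lemma integrable_abs_rpow_sobolevExp (hN : 3 ≤ N) (hA : 0 < A) (w : energySpace N α A) :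
    Integrable (fun x => |toFun w x| ^ sobolevExp N) := by
  obtain ⟨C, -, h⟩ := lintegral_sobolevExp_le hN
  have hm := measurable_toFun w
  refine ⟨(hm.abs.pow_const _).aestronglyMeasurable, ?_⟩
  rw [hasFiniteIntegral_iff_ofReal (Eventually.of_forall fun x => by positivity)]
  exact (h α A hA w).trans_lt ENNReal.ofReal_lt_top

lemma integrable_primitive_mul (hN : 3 ≤ N) (hA : 0 < A) (w : energySpace N α A)
    (hf : Continuous f) (hneg : ∀ s : ℝ, s < 0 → f s = 0) (hM : 0 < M)
    (hg : ∀ s : ℝ, 0 < s → 0 < f s ∧ f s ≤ M * min (s ^ (p₁ - 1)) (s ^ (p₂ - 1)))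
    (hp₁s : p₁ ≤ sobolevExp N) (hp₂s : sobolevExp N ≤ p₂) (t : ℝ) :
    Integrable (fun x => primitive f (t * toFun w x)) := by
  have hs := two_lt_sobolevExp hN
  have hm := measurable_toFun w
  refine ((integrable_abs_rpow_sobolevExp hN hA w).const_mul (M * |t| ^ sobolevExp N)).mono'
    ((continuous_primitive hf).measurable.comp (hm.const_mul t)).aestronglyMeasurable
    (Eventually.of_forall fun x => ?_)
  refine (abs_primitive_le hf hneg hM hg hp₁s hp₂s (by linarith) _).trans (le_of_eq ?_)
  rw [abs_mul, Real.mul_rpow (abs_nonneg _) (abs_nonneg _), mul_assoc]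

lemma energy_smul (hN : 3 ≤ N) (hA : 0 < A) (w : energySpace N α A) (t : ℝ) :
    energy N α A f (t • w) = 1 / 2 * (t ^ 2 * ‖w‖ ^ 2) - ∫ x, primitive f (t * toFun w x) := by
  rw [energy, norm_smul, mul_pow, Real.norm_eq_abs, sq_abs]
  congr 1
  refine integral_congr_ae ?_
  filter_upwards [toFun_smul hN hA t w] with x hx
  rw [hx]

/-- Dominated differentiation under the integral. The derivative along a ray is enough, because the
chain rule extracts the Nehari identity from `I'(w) = 0` without differentiating `I` in general. -/
lemma hasDerivAt_integral_primitive (hN : 3 ≤ N) (hA : 0 < A) (w : energySpace N α A)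
    (hf : Continuous f) (hneg : ∀ s : ℝ, s < 0 → f s = 0) (hM : 0 < M)
    (hg : ∀ s : ℝ, 0 < s → 0 < f s ∧ f s ≤ M * min (s ^ (p₁ - 1)) (s ^ (p₂ - 1)))
    (hp₁s : p₁ ≤ sobolevExp N) (hp₂s : sobolevExp N ≤ p₂) :
    Integrable (fun x => f (toFun w x) * toFun w x) ∧
    HasDerivAt (fun t : ℝ => ∫ x, primitive f (t * toFun w x))
      (∫ x, f (toFun w x) * toFun w x) 1 := by
  have hs := two_lt_sobolevExp hN
  have hm := measurable_toFun w
  have := hasDerivAt_integral_of_dominated_loc_of_deriv_le (μ := (volume : Measure (Space N)))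
    (F := fun t x => primitive f (t * toFun w x))
    (F' := fun t x => f (t * toFun w x) * toFun w x) (x₀ := (1 : ℝ))
    -- The 2 bounds `|t|` on the unit ball around `t = 1`.
    (bound := fun x => M * 2 ^ (sobolevExp N - 1) * |toFun w x| ^ sobolevExp N)
    (Metric.ball_mem_nhds 1 one_pos)
    (Eventually.of_forall fun t =>
      ((continuous_primitive hf).measurable.comp (hm.const_mul t)).aestronglyMeasurable)
    (integrable_primitive_mul hN hA w hf hneg hM hg hp₁s hp₂s 1)
    ((hf.measurable.comp (hm.const_mul 1)).mul hm).aestronglyMeasurable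
    (Eventually.of_forall fun x t ht => ?_)
    ((integrable_abs_rpow_sobolevExp hN hA w).const_mul _)
    (Eventually.of_forall fun x t _ => ?_)
  · simpa only [one_mul] using this
  · have ht2 : |t| ≤ 2 := by
      rw [Metric.mem_ball, Real.dist_eq, abs_lt] at ht
      rw [abs_le]
      constructor <;> linarith
    rw [norm_mul, Real.norm_eq_abs, Real.norm_eq_abs]
    calc |f (t * toFun w x)| * |toFun w x|
        ≤ (M * |t * toFun w x| ^ (sobolevExp N - 1)) * |toFun w x| := by
          gcongr
          exact abs_le_rpow hf hneg hM hg hp₁s hp₂s _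
      _ ≤ (M * (2 ^ (sobolevExp N - 1) * |toFun w x| ^ (sobolevExp N - 1))) * |toFun w x| := by
          rw [abs_mul, Real.mul_rpow (abs_nonneg _) (abs_nonneg _)]
          gcongr
          linarith
      _ = _ := by
          rw [← mul_assoc, mul_assoc]
          congr 1
          rcases eq_or_ne (toFun w x) 0 with h0 | h0
          · rw [h0, abs_zero, mul_zero, Real.zero_rpow (by linarith)]
          · rw [← Real.rpow_add_one (abs_pos.2 h0).ne', sub_add_cancel]
  · have h1 : HasDerivAt (fun t : ℝ => t * toFun w x) (toFun w x) t := by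
      simpa using (hasDerivAt_id t).mul_const (toFun w x)
    exact (hasDerivAt_primitive hf _).comp t h1

/-- A critical point lies on the Nehari manifold. -/
lemma IsCritical.norm_sq_eq (hN : 3 ≤ N) (hA : 0 < A) {w : energySpace N α A}
    (hf : Continuous f) (hneg : ∀ s : ℝ, s < 0 → f s = 0) (hM : 0 < M)
    (hg : ∀ s : ℝ, 0 < s → 0 < f s ∧ f s ≤ M * min (s ^ (p₁ - 1)) (s ^ (p₂ - 1)))
    (hp₁s : p₁ ≤ sobolevExp N) (hp₂s : sobolevExp N ≤ p₂) (hw : IsCritical N α A f w) :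
    ‖w‖ ^ 2 = ∫ x, f (toFun w x) * toFun w x := by
  have h1 := (hasDerivAt_integral_primitive hN hA w hf hneg hM hg hp₁s hp₂s).2
  have h2 : HasDerivAt (fun t : ℝ => 1 / 2 * (t ^ 2 * ‖w‖ ^ 2)) (‖w‖ ^ 2) 1 := by
    refine (((hasDerivAt_pow 2 (1 : ℝ)).mul_const (‖w‖ ^ 2)).const_mul (1 / 2)).congr_deriv ?_
    push_cast
    ring
  have h3 := h2.sub h1
  have h4 : HasDerivAt (fun t : ℝ => t • w) w 1 := by
    simpa using (hasDerivAt_id (1 : ℝ)).smul_const w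
  have h5 : HasFDerivAt (energy N α A f) (0 : energySpace N α A →L[ℝ] ℝ) ((1 : ℝ) • w) := by
    rw [one_smul]; exact hw
  have h6 := h5.comp_hasDerivAt (1 : ℝ) h4
  have h7 : (energy N α A f ∘ fun t : ℝ => t • w) =
      (fun t : ℝ => 1 / 2 * (t ^ 2 * ‖w‖ ^ 2)) - fun t => ∫ x, primitive f (t * toFun w x) := by
    ext t
    exact energy_smul hN hA w t
  rw [h7] at h6
  have := h3.unique h6
  simp only [zero_apply] at this
  linarith

/-- A critical point maximizes the energy along its ray. -/
lemma IsCritical.energy_smul_le (hN : 3 ≤ N) (hA : 0 < A) {w : energySpace N α A}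
    (hf : Continuous f) (hneg : ∀ s : ℝ, s < 0 → f s = 0) (hM : 0 < M)
    (hg : ∀ s : ℝ, 0 < s → 0 < f s ∧ f s ≤ M * min (s ^ (p₁ - 1)) (s ^ (p₂ - 1)))
    (h1 : MonotoneOn (fun s : ℝ => f s / s) (Set.Ioi 0))
    (hp₁s : p₁ ≤ sobolevExp N) (hp₂s : sobolevExp N ≤ p₂) (hw : IsCritical N α A f w)
    {t : ℝ} (ht : 0 ≤ t) : energy N α A f (t • w) ≤ energy N α A f w := by
  have hnehari := hw.norm_sq_eq hN hA hf hneg hM hg hp₁s hp₂s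
  have hint := (hasDerivAt_integral_primitive hN hA w hf hneg hM hg hp₁s hp₂s).1
  have hi := integrable_primitive_mul hN hA w hf hneg hM hg hp₁s hp₂s
  have hi1 := hi 1
  simp only [one_mul] at hi1
  -- By the Nehari identity the left side integrates to `(t² - 1)/2 · ‖w‖²`, the change of the
  -- quadratic part of the energy.
  have h := integral_mono (hint.const_mul ((t ^ 2 - 1) / 2)) ((hi t).sub hi1)
    fun x => primitive_sub_ge hf hneg h1 ht (toFun w x)
  rw [integral_const_mul, ← hnehari] at h
  have h2 : ∫ x, ((fun x => primitive f (t * toFun w x)) - fun x => primitive f (toFun w x)) x =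
      (∫ x, primitive f (t * toFun w x)) - ∫ x, primitive f (toFun w x) :=
    integral_sub (hi t) hi1
  rw [h2] at h
  rw [energy_smul hN hA, energy]
  linarith

end Energy

/-! ### Ordering of the exponents and the lower bound for the level. -/

lemma radialExp_lt_sobolevExp {N : ℕ} (hN : 3 ≤ N) {α : ℝ} (h : α < 2) :
    radialExp N α < sobolevExp N := by
  have hN' : (3 : ℝ) ≤ N := by exact_mod_cast hN
  rw [radialExp, sobolevExp, ← mul_div_assoc, div_lt_div_iff₀ (by linarith) (by linarith)]
  nlinarith

lemma sobolevExp_lt_radialExp {N : ℕ} (hN : 3 ≤ N) {α : ℝ} (h : 2 < α)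
    (hα : α < 2 * (N : ℝ) - 2) : sobolevExp N < radialExp N α := by
  have hN' : (3 : ℝ) ≤ N := by exact_mod_cast hN
  rw [radialExp, sobolevExp, ← mul_div_assoc, div_lt_div_iff₀ (by linarith) (by linarith)]
  nlinarith

/-- A number between `q` and `s` is a convex combination of them. -/
lemma exists_interpolation {q s p : ℝ} (h : q < s ∧ q ≤ p ∧ p ≤ s ∨ s < q ∧ s ≤ p ∧ p ≤ q) :
    ∃ t : ℝ, 0 ≤ t ∧ t ≤ 1 ∧ p = t * q + (1 - t) * s := by
  rcases h with ⟨h1, h2, h3⟩ | ⟨h1, h2, h3⟩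
  · refine ⟨(s - p) / (s - q), div_nonneg (by linarith) (by linarith),
      (div_le_one (by linarith)).2 (by linarith), ?_⟩
    have : s - q ≠ 0 := by linarith
    field_simp
    ring
  · refine ⟨(p - s) / (q - s), div_nonneg (by linarith) (by linarith),
      (div_le_one (by linarith)).2 (by linarith), ?_⟩
    have : q - s ≠ 0 := by linarith
    field_simp
    ring

end RadialLevels

theorem proposition2p2 (N : ℕ) (hN : 3 ≤ N) (α : ℝ) (hα0 : 0 < α) (hα : α < 2 * (N : ℝ) - 2)
    (hα2 : α ≠ 2) (p₁ p₂ : ℝ) (hp₁ : 2 < p₁) (hp₂ : 2 < p₂)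
    (hp₁s : p₁ ≤ RadialLevels.sobolevExp N) (hp₂s : RadialLevels.sobolevExp N ≤ p₂)
    (f : ℝ → ℝ) (hf : Continuous f) (hneg : ∀ s : ℝ, s < 0 → f s = 0)
    (h0 : RadialLevels.DoublePowerGrowth f p₁ p₂)
    (h1 : MonotoneOn (fun s : ℝ => f s / s) (Set.Ioi 0))
    (p : ℝ) (hp_lt : α < 2 → p = max (RadialLevels.radialExp N α) p₁)
    (hp_gt : 2 < α → p = min (RadialLevels.radialExp N α) p₂) :
    ∃ C₀ : ℝ, 0 < C₀ ∧ ∀ A : ℝ, 0 < A →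
      ((C₀ * A ^ (((N : ℝ) - 2) / (α - 2) * ((p - RadialLevels.sobolevExp N) / (p - 2))) : ℝ)
        : EReal) ≤ RadialLevels.radialLevel N α A f := by
  open RadialLevels in
  obtain ⟨M, hM, hg⟩ := h0
  have hs := two_lt_sobolevExp hN
  have hp : 2 < p ∧ p₁ ≤ p ∧ p ≤ p₂ ∧
      ∃ t : ℝ, 0 ≤ t ∧ t ≤ 1 ∧ p = t * radialExp N α + (1 - t) * sobolevExp N := by
    rcases lt_or_gt_of_ne hα2 with h | h
    · have hq := radialExp_lt_sobolevExp hN h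
      have e1 : p₁ ≤ p := hp_lt h ▸ le_max_right _ _
      have e2 : radialExp N α ≤ p := hp_lt h ▸ le_max_left _ _
      have e3 : p ≤ sobolevExp N := hp_lt h ▸ max_le hq.le hp₁s
      exact ⟨by linarith, e1, by linarith, exists_interpolation (Or.inl ⟨hq, e2, e3⟩)⟩
    · have hq := sobolevExp_lt_radialExp hN h hα
      have e1 : p ≤ p₂ := hp_gt h ▸ min_le_right _ _
      have e2 : p ≤ radialExp N α := hp_gt h ▸ min_le_left _ _
      have e3 : sobolevExp N ≤ p := hp_gt h ▸ le_min hq.le hp₂s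
      exact ⟨by linarith, by linarith, e1, exists_interpolation (Or.inr ⟨hq, e3, e2⟩)⟩
  obtain ⟨hp2, hpp₁, hpp₂, t, ht0, ht1, hpt⟩ := hp
  obtain ⟨C, hC, hemb⟩ := lintegral_rpow_le hN hα0 hα hα2 ht0 ht1 hpt
  -- This is `τ²/4` for the `τ` below, stripped of its power of `A`.
  refine ⟨1 / 4 * (4 * (M * C)) ^ (-(2 / (p - 2))), by positivity, fun A hA => ?_⟩
  refine le_sInf ?_
  rintro c ⟨w, hwr, hw0, hwc, rfl⟩
  rw [EReal.coe_le_coe_iff]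
  set K := M * (C * A ^ (-(((N : ℝ) - 2) * (p - sobolevExp N) / (2 * (α - 2))))) with hK
  have hK0 : 0 < K := by positivity
  have hE : 0 < ‖w‖ := norm_pos_iff.2 hw0
  -- The solution of `K τ^p = τ²/4`, so that half of the quadratic term `τ²/2` survives. The test
  -- point is `w` rescaled to norm `τ`.
  set τ := (4 * K) ^ (-(1 / (p - 2))) with hτ
  have hτ0 : 0 < τ := by positivity
  have hp2' : 0 < p - 2 := by linarith
  have hm := measurable_toFun w
  have hF : ∫ x, primitive f (τ / ‖w‖ * toFun w x) ≤ K * τ ^ p := by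
    have hb : ∫⁻ x, ENNReal.ofReal (|toFun w x| ^ p) ≤ _ := hemb A hA w hwr
    have hint : Integrable (fun x => |toFun w x| ^ p) := by
      refine ⟨(hm.abs.pow_const _).aestronglyMeasurable, ?_⟩
      rw [hasFiniteIntegral_iff_ofReal (Eventually.of_forall fun x => by positivity)]
      exact hb.trans_lt ENNReal.ofReal_lt_top
    have hI : ∫ x, |toFun w x| ^ p ≤
        C * A ^ (-(((N : ℝ) - 2) * (p - sobolevExp N) / (2 * (α - 2)))) * ‖w‖ ^ p := by
      rw [integral_eq_lintegral_of_nonneg_ae (Eventually.of_forall fun x => by positivity)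
        hint.1]
      exact ENNReal.toReal_le_of_le_ofReal (by positivity) hb
    calc _ ≤ ∫ x, M * (τ / ‖w‖) ^ p * |toFun w x| ^ p := by
          refine integral_mono
            (integrable_primitive_mul hN hA w hf hneg hM hg hp₁s hp₂s _) (hint.const_mul _)
            fun x => ?_
          refine (le_abs_self _).trans
            ((abs_primitive_le hf hneg hM hg hpp₁ hpp₂ (by linarith) _).trans (le_of_eq ?_))
          rw [abs_mul, Real.mul_rpow (abs_nonneg _) (abs_nonneg _), abs_of_pos (by positivity),
            mul_assoc]
      _ ≤ M * (τ / ‖w‖) ^ p *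
          (C * A ^ (-(((N : ℝ) - 2) * (p - sobolevExp N) / (2 * (α - 2)))) * ‖w‖ ^ p) := by
          rw [integral_const_mul]
          gcongr
      _ = _ := by
          rw [Real.div_rpow hτ0.le hE.le, hK]
          field_simp
  have hτp : τ ^ p = τ ^ 2 / (4 * K) := by
    have e1 : τ ^ (p - 2) = (4 * K)⁻¹ := by
      rw [hτ, ← Real.rpow_mul (by positivity), ← Real.rpow_neg_one]
      congr 1
      field_simp
    calc τ ^ p = τ ^ (2 : ℝ) * τ ^ (p - 2) := by
          rw [← Real.rpow_add hτ0]; congr 1; ring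
      _ = _ := by rw [e1, div_eq_mul_inv]; norm_cast
  have hτ2 : τ ^ 2 = (4 * (M * C)) ^ (-(2 / (p - 2))) *
      A ^ (((N : ℝ) - 2) / (α - 2) * ((p - sobolevExp N) / (p - 2))) := by
    rw [hτ, hK, ← Real.rpow_natCast, ← Real.rpow_mul (by positivity), ← mul_assoc, ← mul_assoc,
      mul_assoc 4, Real.mul_rpow (by positivity) (by positivity), ← Real.rpow_mul hA.le]
    congr 2
    · push_cast; ring
    · have : α - 2 ≠ 0 := sub_ne_zero.2 hα2
      push_cast
      field_simp
  have hle := hwc.energy_smul_le hN hA hf hneg hM hg h1 hp₁s hp₂s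
    (t := τ / ‖w‖) (by positivity)
  rw [energy_smul hN hA] at hle
  have e3 : (τ / ‖w‖) ^ 2 * ‖w‖ ^ 2 = τ ^ 2 := by
    rw [div_pow, div_mul_cancel₀ _ (by positivity)]
  have e4 : K * τ ^ p = 1 / 4 * τ ^ 2 := by
    rw [hτp]
    field_simp
  rw [e3] at hle
  rw [mul_assoc, ← hτ2]
  linarith
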